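/- Let $(M,g)$ be a smooth $(d+1)$-dimensional stationary spacetime: $g$ is a smooth Lorentzian metric of signature $(-,+,\dots,+)$, and $K$ is a smooth, everywhere timelike Killing field with complete orbits, i.e. generating a one-parameter group $(\theta_t)_{t\in\mathbb R}$ of isometries; time is oriented so that $K$ is future directed. Let $\Sigma$ be a smooth (Hausdorff, second countable) $d$-manifold, smoothly embedded in $M$ as a spacelike hypersurface $\Sigma_0$ that meets each orbit of $K$ exactly once, so that $(t,p)\mapsto\theta_t(p)$ is a bijection $\mathbb R\times\Sigma_0\to M$ and the translates $\Sigma_t=\theta_t(\Sigma_0)$ foliate $M$. Let $\gamma_{ab}$ be the induced Riemannian metric on $\Sigma$, $D_a$ its Levi-Civita connection, $d\gamma$ its volume measure, $n^a$ the future-directed unit normal, and let the lapse $\alpha>0$ and the shift $\beta^a$ (tangent to $\Sigma$) be defined by $K^a=\alpha n^a+\beta^a$. Let $m\in\mathbb R$ and $\epsilon>0$, and assume $$m^2>0\qquad\text{and}\qquad \alpha-\frac{\beta_a\beta^a}{\alpha}\ \ge\ \epsilon\quad\text{on }\Sigma .$$ On pairs $\Phi=(\varphi,\pi)\in C_0^\infty(\Sigma)\oplus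 C_0^\infty(\Sigma)$ of real functions put $$\|\Phi\|_{\mathcal A}^2=\int_\Sigma \alpha\Big(\Big[1-\frac{\beta_a\beta^a}{\alpha^2}\Big]\pi^2+\gamma^{ab}\Big[D_a\varphi+\frac{\beta_a}{\alpha}\pi\Big]\Big[D_b\varphi+\frac{\beta_b}{\alpha}\pi\Big]+m^2\varphi^2\Big)\,d\gamma ,$$ let $\mathcal H_{\mathcal A}$ be the real Hilbert space obtained by completing $C_0^\infty(\Sigma)\oplus C_0^\infty(\Sigma)$ in this norm, and let $$h(\varphi,\pi)=\big(-\beta^aD_a\varphi-\alpha\pi,\ -(D^a\alpha)D_a\varphi+\alpha(m^2-D^aD_a)\varphi-(D_a\beta^a)\pi-\beta^aD_a\pi\big),$$ an operator in $\mathcal H_{\mathcal A}$ with domain $C_0^\infty(\Sigma)\oplus C_0^\infty(\Sigma)$. Let $$\sigma\big((\varphi,\pi),(\varphi',\pi')\big)=\int_\Sigma(\varphi\,\pi'-\pi\,\varphi')\,d\gamma .$$ Then $\sigma$ extends to a continuous bilinear form (again denoted $\sigma$) on $\mathcal H_{\mathcal A}$; there is a bounded operator $T$ on $\mathcal H_{\mathcal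 A}$ with $T^*=-T$ and $\sigma(\Phi,\Psi)=\langle\Phi,T\Psi\rangle_{\mathcal A}$ for all $\Phi,\Psi\in\mathcal H_{\mathcal A}$; $T$ is injective, and $h^{SA}:=T^{-1}$, with domain $\operatorname{Ran}T$, is a densely defined skew-adjoint operator (that is, $(h^{SA})^*=-h^{SA}$) that extends $h$. Thus $h$ has a skew-adjoint extension with bounded inverse $T$. Moreover this extension conserves $\sigma$: the strongly continuous one-parameter group of isometries $e^{-h^{SA}t}$ with generator $-h^{SA}$ exists and satisfies $$\sigma(e^{-h^{SA}t}\Phi,e^{-h^{SA}t}\Psi)=\sigma(\Phi,\Psi)\qquad\text{for all }t\in\mathbb R,\ \Phi,\Psi\in\mathcal H_{\mathcal A}.$$ -/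

import Mathlib

open Bundle Manifold MeasureTheory Set Topology
open scoped ContDiff InnerProductSpace

set_option linter.unusedSectionVars false

noncomputable section
namespace StationaryKG

section Riemannian
variable {d : ℕ} {X : Type*} [TopologicalSpace X] [ChartedSpace (EuclideanSpace ℝ (Fin d)) X]
  [IsManifold (𝓡 d) ∞ X]

/-- Smooth Riemannian metrics on the `d`-dimensional manifold `X`. -/
abbrev RMetric (d : ℕ) (X : Type*) [TopologicalSpace X]
    [ChartedSpace (EuclideanSpace ℝ (Fin d)) X] [IsManifold (𝓡 d) ∞ X] :=
  ContMDiffRiemannianMetric (𝓡 d) ∞ (EuclideanSpace ℝ (Fin d))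
    (fun p : X => TangentSpace (𝓡 d) p)

/-- Raising an index: `sharp γ p η` is the vector `v` with `γ(v, ·) = η`. -/
def sharp (γ : RMetric d X) (p : X) (η : TangentSpace (𝓡 d) p →L[ℝ] ℝ) : TangentSpace (𝓡 d) p :=
  (γ.inner p).inverse η

theorem metric_isInvertible (γ : RMetric d X) (p : X) : (γ.inner p).IsInvertible := by
  have : FiniteDimensional ℝ (TangentSpace (𝓡 d) p) :=
    inferInstanceAs (FiniteDimensional ℝ (EuclideanSpace ℝ (Fin d)))
  have : T2Space (TangentSpace (𝓡 d) p) :=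
    inferInstanceAs (T2Space (EuclideanSpace ℝ (Fin d)))
  let f : TangentSpace (𝓡 d) p →ₗ[ℝ] Module.Dual ℝ (TangentSpace (𝓡 d) p) :=
    { toFun := fun v => (γ.inner p v : TangentSpace (𝓡 d) p →ₗ[ℝ] ℝ)
      map_add' := fun v w => by ext; simp
      map_smul' := fun c w => by ext; simp }
  have hf : Function.Injective f := by
    rw [injective_iff_map_eq_zero]
    intro v hv
    by_contra h
    have h1 := γ.pos p v h
    have h2 : f v v = 0 := by rw [hv]; rfl
    exact h1.ne' h2
  have hs : Function.Surjective f :=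
    (LinearMap.injective_iff_surjective_of_finrank_eq_finrank
      (Subspace.dual_finrank_eq (K := ℝ) (V := TangentSpace (𝓡 d) p)).symm).1 hf
  have hb : Function.Bijective (γ.inner p) := by
    constructor
    · intro v w h
      apply hf
      ext x
      exact congrArg (fun l => l x) h
    · intro η
      obtain ⟨v, hv⟩ := hs η.toLinearMap
      refine ⟨v, ?_⟩
      ext x
      exact congrArg (fun l => l x) hv
  exact ⟨(LinearEquiv.ofBijective (γ.inner p).toLinearMap hb).toContinuousLinearEquiv, by ext; rfl⟩

theorem inner_sharp (γ : RMetric d X) (p : X) (η : TangentSpace (𝓡 d) p →L[ℝ] ℝ) :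
    γ.inner p (sharp γ p η) = η :=
  (metric_isInvertible γ p).self_apply_inverse η

/-- The gradient `D^a f`. -/
def grad (γ : RMetric d X) (f : X → ℝ) (p : X) : TangentSpace (𝓡 d) p :=
  sharp γ p (mvfderiv (𝓡 d) f p)

/-- The coordinate vector field `∂_i` of the chart at `q`, at the point with coordinates `y`. -/
def coordVec (q : X) (y : EuclideanSpace ℝ (Fin d)) (i : Fin d) :
    TangentSpace (𝓡 d) ((extChartAt (𝓡 d) q).symm y) :=
  mfderiv 𝓘(ℝ, EuclideanSpace ℝ (Fin d)) (𝓡 d) (extChartAt (𝓡 d) q).symm y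
    (EuclideanSpace.single i 1)

/-- The matrix `γ_ij` of the metric in the chart at `q`. -/
def gram (γ : RMetric d X) (q : X) (y : EuclideanSpace ℝ (Fin d)) : Matrix (Fin d) (Fin d) ℝ :=
  Matrix.of fun i j => γ.inner ((extChartAt (𝓡 d) q).symm y) (coordVec q y i) (coordVec q y j)

/-- The volume density `√(det γ_ij)` in the chart at `q`. -/
def volDensity (γ : RMetric d X) (q : X) (y : EuclideanSpace ℝ (Fin d)) : ℝ :=
  Real.sqrt (gram γ q y).det

/-- The measure `√(det γ_ij) dx¹ ⋯ dx^d` on the domain of the chart at `q`. -/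
def chartVolume [MeasurableSpace X] (γ : RMetric d X) (q : X) : Measure X :=
  ((volume.restrict (extChartAt (𝓡 d) q).target).withDensity
    fun y => ENNReal.ofReal (volDensity γ q y)).map (extChartAt (𝓡 d) q).symm

/-- The Riemannian volume measure `dγ`: the chart volumes agree on overlaps of chart domains
(`chartVolume_eq`), and `dγ` is the smallest measure that dominates all of them. -/
def riemVolume [MeasurableSpace X] (γ : RMetric d X) : Measure X := ⨆ q : X, chartVolume γ q

/-- The `i`-th component of the vector field `V` in the chart at `q`. -/
def coordComp (V : ∀ p : X, TangentSpace (𝓡 d) p) (q : X) (y : EuclideanSpace ℝ (Fin d))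
    (i : Fin d) : ℝ :=
  mvfderiv (𝓡 d) (extChartAt (𝓡 d) q) ((extChartAt (𝓡 d) q).symm y)
    (V ((extChartAt (𝓡 d) q).symm y)) i

/-- The divergence `D_a V^a = (det γ)^{-1/2} ∂_i ((det γ)^{1/2} V^i)`. -/
def divergence (γ : RMetric d X) (V : ∀ p : X, TangentSpace (𝓡 d) p) (q : X) : ℝ :=
  (volDensity γ q (extChartAt (𝓡 d) q q))⁻¹ *
    ∑ i : Fin d, fderiv ℝ (fun y => volDensity γ q y * coordComp V q y i)
      (extChartAt (𝓡 d) q q) (EuclideanSpace.single i 1)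

/-- The Laplace–Beltrami operator `D^a D_a f`. -/
def laplacian (γ : RMetric d X) (f : X → ℝ) : X → ℝ := divergence γ (grad γ f)


theorem contMDiff_sharp (γ : RMetric d X) {η : ∀ p : X, TangentSpace (𝓡 d) p →L[ℝ] ℝ}
    (hη : ContMDiff (𝓡 d) ((𝓡 d).prod 𝓘(ℝ, EuclideanSpace ℝ (Fin d) →L[ℝ] ℝ)) ∞
      (fun p => TotalSpace.mk' (EuclideanSpace ℝ (Fin d) →L[ℝ] ℝ) p (η p))) :
    ContMDiff (𝓡 d) (𝓡 d).tangent ∞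
      (fun p => (⟨p, sharp γ p (η p)⟩ : TangentBundle (𝓡 d) X)) := by
  intro x₀
  have hγ := γ.contMDiff x₀
  rw [contMDiffAt_hom_bundle] at hγ
  have h2 := hγ.2
  simp only at h2
  set E := EuclideanSpace ℝ (Fin d) with hE
  let T : X → Type := fun p : X => TangentSpace (𝓡 d) p
  let T' : X → Type := fun p : X => T p →L[ℝ] ℝ
  have h3 : ContMDiffAt (𝓡 d) 𝓘(ℝ, (E →L[ℝ] ℝ) →L[ℝ] E) ∞
      (ContinuousLinearMap.inverse ∘ (fun x : X => ContinuousLinearMap.inCoordinates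
        E T (E →L[ℝ] ℝ) T' x₀ x x₀ x (γ.inner x))) x₀ := by
    apply ContMDiffAt.comp _ _ h2
    apply ContDiffAt.contMDiffAt
    apply ContinuousLinearMap.IsInvertible.contDiffAt_map_inverse
    rw [ContinuousLinearMap.inCoordinates_eq (FiberBundle.mem_baseSet_trivializationAt' x₀)
      (FiberBundle.mem_baseSet_trivializationAt' x₀)]
    exact ContinuousLinearMap.isInvertible_equiv.comp
      ((metric_isInvertible γ x₀).comp ContinuousLinearMap.isInvertible_equiv)
  refine ContMDiffAt.clm_apply_of_inCoordinates (F₁ := E →L[ℝ] ℝ) (E₁ := T') (F₂ := E) (E₂ := T)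
    (b₁ := id) (b₂ := id) (ϕ := fun p => (γ.inner p).inverse) (v := η) ?_ (hη x₀) contMDiffAt_id
  apply h3.congr_of_eventuallyEq
  have A : (trivializationAt E T x₀).baseSet ∈ 𝓝 x₀ :=
    (trivializationAt _ _ _).open_baseSet.mem_nhds (FiberBundle.mem_baseSet_trivializationAt' _)
  have B : (trivializationAt (E →L[ℝ] ℝ) T' x₀).baseSet ∈ 𝓝 x₀ :=
    (trivializationAt _ _ _).open_baseSet.mem_nhds (FiberBundle.mem_baseSet_trivializationAt' _)
  filter_upwards [A, B] with x hx h'x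
  simp only [Function.comp_apply]
  rw [ContinuousLinearMap.inCoordinates_eq hx h'x]
  refine (ContinuousLinearMap.inCoordinates_eq (ϕ := (γ.inner x).inverse) h'x hx).trans ?_
  simp only [ContinuousLinearMap.inverse_equiv_comp, ContinuousLinearMap.inverse_comp_equiv,
    ContinuousLinearEquiv.symm_symm]
  rfl

theorem contMDiff_mvfderiv {f : X → ℝ} (hf : ContMDiff (𝓡 d) 𝓘(ℝ) ∞ f) :
    ContMDiff (𝓡 d) ((𝓡 d).prod 𝓘(ℝ, EuclideanSpace ℝ (Fin d) →L[ℝ] ℝ)) ∞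
      (fun p => TotalSpace.mk' (EuclideanSpace ℝ (Fin d) →L[ℝ] ℝ)
        (E := fun p : X => TangentSpace (𝓡 d) p →L[ℝ] ℝ) p (mvfderiv (𝓡 d) f p)) := by
  intro x₀
  rw [contMDiffAt_hom_bundle]
  refine ⟨contMDiffAt_id, ?_⟩
  have h := (hf x₀).mfderiv_const (m := ∞) (by simp)
  apply h.congr_of_eventuallyEq
  filter_upwards with x
  ext v
  simp [inTangentCoordinates, ContinuousLinearMap.inCoordinates, mvfderiv]
  rfl


/-- The inverse trivialization of the tangent bundle given by the chart at `q`. -/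
theorem coordVec_eq (q : X) {y : EuclideanSpace ℝ (Fin d)} (hy : y ∈ (extChartAt (𝓡 d) q).target)
    (i : Fin d) :
    coordVec q y i = (trivializationAt (EuclideanSpace ℝ (Fin d)) (TangentSpace (𝓡 d)) q).symmL ℝ
      ((extChartAt (𝓡 d) q).symm y) (EuclideanSpace.single i 1) := by
  rw [TangentBundle.symmL_trivializationAt (by simpa using (extChartAt (𝓡 d) q).map_target hy)]
  simp only [modelWithCornersSelf_coe, range_id, mfderivWithin_univ]
  rw [coordVec, (extChartAt (𝓡 d) q).right_inv hy]
  rfl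

/-- The matrix of the metric in the chart at `q`, as a function on the manifold. -/
def gramAt (γ : RMetric d X) (q p : X) : Matrix (Fin d) (Fin d) ℝ :=
  Matrix.of fun i j => γ.inner p
    ((trivializationAt (EuclideanSpace ℝ (Fin d)) (TangentSpace (𝓡 d)) q).symmL ℝ p
      (EuclideanSpace.single i 1))
    ((trivializationAt (EuclideanSpace ℝ (Fin d)) (TangentSpace (𝓡 d)) q).symmL ℝ p
      (EuclideanSpace.single j 1))

theorem gram_eq (γ : RMetric d X) (q : X) {y : EuclideanSpace ℝ (Fin d)}
    (hy : y ∈ (extChartAt (𝓡 d) q).target) :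
    gram γ q y = gramAt γ q ((extChartAt (𝓡 d) q).symm y) := by
  ext i j
  simp only [gram, gramAt, Matrix.of_apply, coordVec_eq q hy]

/-- The vector field on the domain of the chart at `q` with constant components `v`. -/
def frame (q : X) (v : EuclideanSpace ℝ (Fin d)) (p : X) : TangentSpace (𝓡 d) p :=
  (trivializationAt (EuclideanSpace ℝ (Fin d)) (TangentSpace (𝓡 d)) q).symmL ℝ p v

theorem contMDiffOn_frame (q : X) (v : EuclideanSpace ℝ (Fin d)) :
    ContMDiffOn (𝓡 d) (𝓡 d).tangent ∞ (fun p => (⟨p, frame q v p⟩ : TangentBundle (𝓡 d) X))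
      (chartAt (EuclideanSpace ℝ (Fin d)) q).source := by
  intro p hp
  have hp' : p ∈ (trivializationAt (EuclideanSpace ℝ (Fin d)) (TangentSpace (𝓡 d)) q).baseSet := by
    simpa using hp
  have h1 := ((trivializationAt (EuclideanSpace ℝ (Fin d)) (TangentSpace (𝓡 d)) q).contMDiffAt_symmL
    (n := ∞) (IB := 𝓡 d) hp').contMDiffWithinAt
      (s := (chartAt (EuclideanSpace ℝ (Fin d)) q).source)
  refine ContMDiffWithinAt.clm_bundle_apply (F₁ := EuclideanSpace ℝ (Fin d))
    (E₁ := Bundle.Trivial X (EuclideanSpace ℝ (Fin d))) (b := id) (v := fun _ => v) h1 ?_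
  rw [Bundle.contMDiffWithinAt_totalSpace]
  exact ⟨contMDiffWithinAt_id, contMDiffWithinAt_const⟩

theorem contMDiffOn_gramAt (γ : RMetric d X) (q : X) (i j : Fin d) :
    ContMDiffOn (𝓡 d) 𝓘(ℝ) ∞ (fun p => gramAt γ q p i j)
      (chartAt (EuclideanSpace ℝ (Fin d)) q).source := by
  intro p hp
  have := ContMDiffWithinAt.clm_bundle_apply₂ (F₁ := EuclideanSpace ℝ (Fin d))
    (F₂ := EuclideanSpace ℝ (Fin d)) (F₃ := ℝ) (E₃ := Bundle.Trivial X ℝ)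
    (b := id) (γ.contMDiff p).contMDiffWithinAt
    (contMDiffOn_frame q (EuclideanSpace.single i 1) p hp)
    (contMDiffOn_frame q (EuclideanSpace.single j 1) p hp)
  rw [Bundle.contMDiffWithinAt_totalSpace] at this
  exact this.2

/-- A covector field is smooth if its components in charts are. -/
theorem contMDiff_covector {η : ∀ p : X, TangentSpace (𝓡 d) p →L[ℝ] ℝ}
    (h : ∀ q v, ContMDiffOn (𝓡 d) 𝓘(ℝ) ∞ (fun p => η p (frame q v p))
      (chartAt (EuclideanSpace ℝ (Fin d)) q).source) :
    ContMDiff (𝓡 d) ((𝓡 d).prod 𝓘(ℝ, EuclideanSpace ℝ (Fin d) →L[ℝ] ℝ)) ∞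
      (fun p => TotalSpace.mk' (EuclideanSpace ℝ (Fin d) →L[ℝ] ℝ) p (η p)) := by
  intro q
  rw [contMDiffAt_hom_bundle]
  refine ⟨contMDiffAt_id, ?_⟩
  have hU : (chartAt (EuclideanSpace ℝ (Fin d)) q).source ∈ 𝓝 q :=
    (chartAt (EuclideanSpace ℝ (Fin d)) q).open_source.mem_nhds (mem_chart_source _ q)
  let P : Fin d → (EuclideanSpace ℝ (Fin d) →L[ℝ] ℝ) := fun i => EuclideanSpace.proj i
  have h1 : ContMDiffAt (𝓡 d) 𝓘(ℝ, EuclideanSpace ℝ (Fin d) →L[ℝ] ℝ) ∞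
      (fun p => ∑ i, η p (frame q (EuclideanSpace.single i 1) p) • P i) q := by
    refine ContMDiffAt.sum fun i _ => ?_
    exact ((h q (EuclideanSpace.single i 1)).contMDiffAt hU).smul contMDiffAt_const
  refine h1.congr_of_eventuallyEq ?_
  filter_upwards [hU] with p hp
  ext v
  have hv : v = ∑ i, v i • EuclideanSpace.single i (1 : ℝ) := by
    ext j; simp [Pi.single_apply]
  have hfr : frame q v p = ∑ i, v i • frame q (EuclideanSpace.single i 1) p := by
    conv_lhs => rw [hv]
    simp [frame]
  trans η p (frame q v p)
  · simp [ContinuousLinearMap.inCoordinates, frame]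
  · rw [hfr]
    simp [P, mul_comm]

/-- A field of bilinear forms is smooth if its components in charts are. -/
theorem contMDiff_bilin {B : ∀ p : X, TangentSpace (𝓡 d) p →L[ℝ] TangentSpace (𝓡 d) p →L[ℝ] ℝ}
    (h : ∀ q v w, ContMDiffOn (𝓡 d) 𝓘(ℝ) ∞ (fun p => B p (frame q v p) (frame q w p))
      (chartAt (EuclideanSpace ℝ (Fin d)) q).source) :
    ContMDiff (𝓡 d) ((𝓡 d).prod 𝓘(ℝ, EuclideanSpace ℝ (Fin d) →L[ℝ]
        EuclideanSpace ℝ (Fin d) →L[ℝ] ℝ)) ∞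
      (fun p => TotalSpace.mk' (EuclideanSpace ℝ (Fin d) →L[ℝ]
        EuclideanSpace ℝ (Fin d) →L[ℝ] ℝ) p (B p)) := by
  intro q
  rw [contMDiffAt_hom_bundle]
  refine ⟨contMDiffAt_id, ?_⟩
  have hU : (chartAt (EuclideanSpace ℝ (Fin d)) q).source ∈ 𝓝 q :=
    (chartAt (EuclideanSpace ℝ (Fin d)) q).open_source.mem_nhds (mem_chart_source _ q)
  let P : Fin d → (EuclideanSpace ℝ (Fin d) →L[ℝ] ℝ) := fun i => EuclideanSpace.proj i
  have h1 : ContMDiffAt (𝓡 d) 𝓘(ℝ, EuclideanSpace ℝ (Fin d) →L[ℝ]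
      EuclideanSpace ℝ (Fin d) →L[ℝ] ℝ) ∞
      (fun p => ∑ i, ∑ j, B p (frame q (EuclideanSpace.single i 1) p)
        (frame q (EuclideanSpace.single j 1) p) • (P i).smulRight (P j)) q := by
    refine ContMDiffAt.sum fun i _ => ContMDiffAt.sum fun j _ => ?_
    exact ((h q (EuclideanSpace.single i 1) (EuclideanSpace.single j 1)).contMDiffAt hU).smul
      contMDiffAt_const
  refine h1.congr_of_eventuallyEq ?_
  filter_upwards [hU] with p hp
  ext v w
  have hv : ∀ v : EuclideanSpace ℝ (Fin d), v = ∑ i, v i • EuclideanSpace.single i (1 : ℝ) := by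
    intro v; ext j; simp [Pi.single_apply]
  have hfr : ∀ v : EuclideanSpace ℝ (Fin d),
      frame q v p = ∑ i, v i • frame q (EuclideanSpace.single i 1) p := by
    intro v
    conv_lhs => rw [hv v]
    simp [frame]
  trans B p (frame q v p) (frame q w p)
  · have hp' : p ∈ (trivializationAt (EuclideanSpace ℝ (Fin d)) (TangentSpace (𝓡 d)) q).baseSet := by
      simpa using hp
    refine (inCoordinates_apply_eq₂ hp' hp' (mem_univ _)).trans ?_
    simp [frame, Bundle.Trivialization.symmL_apply _ hp']
  · rw [hfr v, hfr w]
    simp only [map_sum, map_smul, sum_apply, smul_apply, P, ContinuousLinearMap.smulRight_apply,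
      EuclideanSpace.coe_proj, smul_eq_mul, Finset.mul_sum]
    rw [Finset.sum_comm]
    refine Finset.sum_congr rfl fun k _ => Finset.sum_congr rfl fun l _ => ?_
    ring

theorem det_gramAt_change (γ : RMetric d X) {q r p : X}
    (hq : p ∈ (chartAt (EuclideanSpace ℝ (Fin d)) q).source)
    (hr : p ∈ (chartAt (EuclideanSpace ℝ (Fin d)) r).source) :
    (gramAt γ q p).det = (tangentCoordChange (𝓡 d) q r p).det ^ 2 * (gramAt γ r p).det := by
  set J := tangentCoordChange (𝓡 d) q r p with hJ
  have key : ∀ v : EuclideanSpace ℝ (Fin d),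
      (trivializationAt (EuclideanSpace ℝ (Fin d)) (TangentSpace (𝓡 d)) q).symmL ℝ p v =
      (trivializationAt (EuclideanSpace ℝ (Fin d)) (TangentSpace (𝓡 d)) r).symmL ℝ p (J v) := by
    intro v
    rw [TangentBundle.symmL_trivializationAt_eq_core hq,
      TangentBundle.symmL_trivializationAt_eq_core hr]
    exact (tangentCoordChange_comp (I := 𝓡 d) (w := q) (x := r) (y := p) (z := p) (v := v)
      (by simp [hq, hr])).symm
  let b := (EuclideanSpace.basisFun (Fin d) ℝ).toBasis
  let A : Matrix (Fin d) (Fin d) ℝ := LinearMap.toMatrix b b J.toLinearMap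
  have hA : A.det = J.det := LinearMap.det_toMatrix b J.toLinearMap
  have hJe : ∀ i : Fin d, J (EuclideanSpace.single i 1) =
      ∑ k, A k i • (EuclideanSpace.single k (1 : ℝ)) := by
    intro i
    have := b.sum_repr (J (b i))
    simp only [b, OrthonormalBasis.coe_toBasis, EuclideanSpace.basisFun_apply] at this
    rw [← this]
    simp [A, LinearMap.toMatrix_apply, b]
  have hg : gramAt γ q p = A.transpose * gramAt γ r p * A := by
    ext i j
    simp only [gramAt, Matrix.of_apply, key, hJe, map_sum, map_smul,
      sum_apply, smul_apply, Matrix.mul_apply,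
      Matrix.transpose_apply, smul_eq_mul, Finset.sum_mul, Finset.mul_sum]
    refine Finset.sum_congr rfl fun k _ => Finset.sum_congr rfl fun l _ => ?_
    ring
  rw [hg, Matrix.det_mul, Matrix.det_mul, Matrix.det_transpose, hA]
  ring


theorem continuousOn_volDensity (γ : RMetric d X) (q : X) :
    ContinuousOn (volDensity γ q) (extChartAt (𝓡 d) q).target := by
  have h : ContinuousOn (fun y => Real.sqrt (gramAt γ q ((extChartAt (𝓡 d) q).symm y)).det)
      (extChartAt (𝓡 d) q).target := by
    have h1 : ContinuousOn (fun p => gramAt γ q p) (extChartAt (𝓡 d) q).source := by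
      refine continuousOn_pi.2 fun i => continuousOn_pi.2 fun j => ?_
      simpa using (contMDiffOn_gramAt γ q i j).continuousOn
    have h2 : ContinuousOn (fun p => Real.sqrt (gramAt γ q p).det) (extChartAt (𝓡 d) q).source :=
      (Continuous.matrix_det continuous_id).comp_continuousOn h1 |>.sqrt
    exact h2.comp (continuousOn_extChartAt_symm q) (extChartAt (𝓡 d) q).symm.mapsTo
  refine h.congr fun y hy => ?_
  rw [volDensity, gram_eq γ q hy]

section measure
variable [MeasurableSpace X] [BorelSpace X]

theorem measurableSet_chart_preimage (q : X) {s : Set X} (hs : MeasurableSet s) :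
    MeasurableSet ((extChartAt (𝓡 d) q).target ∩ (extChartAt (𝓡 d) q).symm ⁻¹' s) := by
  classical
  have hT : MeasurableSet (extChartAt (𝓡 d) q).target := (isOpen_extChartAt_target q).measurableSet
  have hg : Measurable ((extChartAt (𝓡 d) q).target.piecewise (extChartAt (𝓡 d) q).symm
      (fun _ => q)) :=
    (continuousOn_extChartAt_symm q).measurable_piecewise continuousOn_const hT
  convert! hT.inter (hg hs) using 1
  ext y
  simp only [mem_inter_iff, mem_preimage, and_congr_right_iff]
  intro hy
  rw [piecewise_eq_of_mem _ _ _ hy]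

theorem chartVolume_apply (γ : RMetric d X) (q : X) {s : Set X} (hs : MeasurableSet s) :
    chartVolume γ q s =
      ∫⁻ y in (extChartAt (𝓡 d) q).target ∩ (extChartAt (𝓡 d) q).symm ⁻¹' s,
        ENNReal.ofReal (volDensity γ q y) := by
  have hT : MeasurableSet (extChartAt (𝓡 d) q).target := (isOpen_extChartAt_target q).measurableSet
  have hm : AEMeasurable (extChartAt (𝓡 d) q).symm
      (volume.restrict (extChartAt (𝓡 d) q).target) :=
    (continuousOn_extChartAt_symm q).aemeasurable hT
  rw [chartVolume, Measure.map_apply_of_aemeasurable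
    (hm.mono_ac (withDensity_absolutelyContinuous _ _)) hs]
  rw [withDensity_apply' _ _, Measure.restrict_restrict₀', inter_comm]
  exact hT.nullMeasurableSet

/-- The chart volumes agree on the overlap of two chart domains. -/
theorem chartVolume_eq (γ : RMetric d X) (q r : X) {s : Set X} (hs : MeasurableSet s)
    (hq : s ⊆ (chartAt (EuclideanSpace ℝ (Fin d)) q).source)
    (hr : s ⊆ (chartAt (EuclideanSpace ℝ (Fin d)) r).source) :
    chartVolume γ q s = chartVolume γ r s := by
  rw [chartVolume_apply γ q hs, chartVolume_apply γ r hs]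
  set A := (extChartAt (𝓡 d) q).target ∩ (extChartAt (𝓡 d) q).symm ⁻¹' s with hA
  have hAm : MeasurableSet A := measurableSet_chart_preimage q hs
  have hq' : s ⊆ (extChartAt (𝓡 d) q).source := by simpa using hq
  have hr' : s ⊆ (extChartAt (𝓡 d) r).source := by simpa using hr
  let φ := (extChartAt (𝓡 d) r) ∘ (extChartAt (𝓡 d) q).symm
  have himg : φ '' A = (extChartAt (𝓡 d) r).target ∩ (extChartAt (𝓡 d) r).symm ⁻¹' s := by
    ext z
    constructor
    · rintro ⟨y, ⟨hy1, hy2⟩, rfl⟩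
      refine ⟨(extChartAt (𝓡 d) r).map_source (hr' hy2), ?_⟩
      change (extChartAt (𝓡 d) r).symm ((extChartAt (𝓡 d) r) ((extChartAt (𝓡 d) q).symm y)) ∈ s
      rw [(extChartAt (𝓡 d) r).left_inv (hr' hy2)]
      exact hy2
    · rintro ⟨hz1, hz2⟩
      have hz3 := hq' hz2
      refine ⟨extChartAt (𝓡 d) q ((extChartAt (𝓡 d) r).symm z),
        ⟨(extChartAt (𝓡 d) q).map_source hz3, ?_⟩, ?_⟩
      · rw [mem_preimage, (extChartAt (𝓡 d) q).left_inv hz3]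
        exact hz2
      · change (extChartAt (𝓡 d) r) ((extChartAt (𝓡 d) q).symm
          (extChartAt (𝓡 d) q ((extChartAt (𝓡 d) r).symm z))) = z
        rw [(extChartAt (𝓡 d) q).left_inv hz3, (extChartAt (𝓡 d) r).right_inv hz1]
  have hinj : InjOn φ A := by
    intro y hy y' hy' h
    have h1 := (extChartAt (𝓡 d) r).injOn (hr' hy.2) (hr' hy'.2) h
    exact (extChartAt (𝓡 d) q).symm.injOn hy.1 hy'.1 h1
  have hder : ∀ y ∈ A, HasFDerivWithinAt φ
      (tangentCoordChange (𝓡 d) q r ((extChartAt (𝓡 d) q).symm y)) A y := by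
    intro y hy
    have := hasFDerivWithinAt_tangentCoordChange (I := 𝓡 d) (x := q) (y := r)
      (z := (extChartAt (𝓡 d) q).symm y) ⟨hq' hy.2, hr' hy.2⟩
    rw [(extChartAt (𝓡 d) q).right_inv hy.1] at this
    exact this.mono (by simp)
  rw [← himg, lintegral_image_eq_lintegral_abs_det_fderiv_mul volume hAm hder hinj]
  refine setLIntegral_congr_fun hAm fun y hy => ?_
  have hφ : φ y ∈ (extChartAt (𝓡 d) r).target := (extChartAt (𝓡 d) r).map_source (hr' hy.2)
  have hφ' : (extChartAt (𝓡 d) r).symm (φ y) = (extChartAt (𝓡 d) q).symm y :=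
    (extChartAt (𝓡 d) r).left_inv (hr' hy.2)
  rw [← ENNReal.ofReal_mul (abs_nonneg _), volDensity, volDensity, gram_eq γ q hy.1,
    gram_eq γ r hφ, hφ', det_gramAt_change γ (hq hy.2) (hr hy.2),
    Real.sqrt_mul (sq_nonneg _), Real.sqrt_sq_eq_abs]

/-- A countable measurable partition of the manifold into subsets of chart domains. -/
theorem exists_partition [SecondCountableTopology X] :
    ∃ (S : Set X) (_ : S.Countable) (A : S → Set X), (∀ q, MeasurableSet (A q)) ∧
      (∀ q : S, A q ⊆ (chartAt (EuclideanSpace ℝ (Fin d)) (q : X)).source) ∧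
      Pairwise (Function.onFun Disjoint A) ∧ ⋃ q, A q = univ := by
  obtain ⟨S, hS, hcov⟩ := TopologicalSpace.countable_cover_nhds
    (fun q : X => (chartAt (EuclideanSpace ℝ (Fin d)) q).open_source.mem_nhds (mem_chart_source _ q))
  have : Countable S := hS
  obtain ⟨e⟩ : Nonempty (Encodable S) := ⟨hS.toEncodable⟩
  let U : S → Set X := fun q => (chartAt (EuclideanSpace ℝ (Fin d)) (q : X)).source
  refine ⟨S, hS, fun q => U q \ ⋃ r : S, ⋃ _ : Encodable.encode r < Encodable.encode q, U r,
    fun q => ?_, fun q => sdiff_subset, ?_, ?_⟩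
  · refine (chartAt _ (q : X)).open_source.measurableSet.diff (MeasurableSet.iUnion fun r =>
      MeasurableSet.iUnion fun _ => (chartAt _ (r : X)).open_source.measurableSet)
  · intro a b hab
    rw [Function.onFun, Set.disjoint_left]
    rintro x ⟨hxa, hxa'⟩ ⟨hxb, hxb'⟩
    simp only [mem_iUnion, not_exists] at hxa' hxb'
    rcases lt_trichotomy (Encodable.encode a) (Encodable.encode b) with h | h | h
    · exact hxb' a h hxa
    · exact hab (Encodable.encode_injective h)
    · exact hxa' b h hxb
  · refine eq_univ_of_forall fun x => ?_
    have hx : ∃ n : ℕ, ∃ r : S, Encodable.encode r = n ∧ x ∈ U r := by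
      have hx : x ∈ ⋃ q ∈ S, (chartAt (EuclideanSpace ℝ (Fin d)) q).source := hcov ▸ mem_univ x
      simp only [mem_iUnion] at hx
      obtain ⟨q, hq, hxq⟩ := hx
      exact ⟨_, ⟨q, hq⟩, rfl, hxq⟩
    classical
    obtain ⟨r, hr, hxr⟩ := Nat.find_spec hx
    refine mem_iUnion.2 ⟨r, hxr, ?_⟩
    simp only [mem_iUnion, not_exists]
    intro r' hr' hxr'
    rw [hr] at hr'
    exact Nat.find_min hx hr' ⟨r', rfl, hxr'⟩

theorem riemVolume_apply [SecondCountableTopology X] (γ : RMetric d X) (q : X) {s : Set X}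
    (hs : MeasurableSet s) (hq : s ⊆ (chartAt (EuclideanSpace ℝ (Fin d)) q).source) :
    riemVolume γ s = chartVolume γ q s := by
  apply le_antisymm _ (le_iSup (chartVolume γ) q s)
  obtain ⟨S, hS, A, hA, hAs, hd, hU⟩ := exists_partition (d := d) (X := X)
  have : Countable S := hS
  let ν : Measure X := Measure.sum fun r : S => (chartVolume γ (r : X)).restrict (A r)
  have hν : ∀ (r : X) (t : Set X), MeasurableSet t →
      chartVolume γ r t ≤ ν t := by
    intro r t ht
    rw [Measure.sum_apply _ ht]
    have h0 : chartVolume γ r t = chartVolume γ r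
        (t ∩ (chartAt (EuclideanSpace ℝ (Fin d)) r).source) := by
      rw [chartVolume_apply γ r ht, chartVolume_apply γ r
        (ht.inter (chartAt (EuclideanSpace ℝ (Fin d)) r).open_source.measurableSet)]
      congr 2
      ext y
      simp only [mem_inter_iff, mem_preimage, and_congr_right_iff]
      intro hy
      have := (extChartAt (𝓡 d) r).map_target hy
      simp only [extChartAt_source] at this
      exact ⟨fun h => ⟨h, this⟩, fun h => h.1⟩
    rw [h0]
    set t' := t ∩ (chartAt (EuclideanSpace ℝ (Fin d)) r).source with ht'
    have ht'm : MeasurableSet t' :=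
      ht.inter (chartAt (EuclideanSpace ℝ (Fin d)) r).open_source.measurableSet
    have h1 : t' = ⋃ p : S, t' ∩ A p := by rw [← inter_iUnion, hU, inter_univ]
    calc chartVolume γ r t' ≤ ∑' p : S, chartVolume γ r (t' ∩ A p) := by
          conv_lhs => rw [h1]
          exact measure_iUnion_le _
      _ ≤ ∑' p : S, ((chartVolume γ (p : X)).restrict (A p)) t := by
          refine ENNReal.tsum_le_tsum fun p => ?_
          rw [Measure.restrict_apply ht, chartVolume_eq γ r p (ht'm.inter (hA p))
            (inter_subset_left.trans inter_subset_right) (inter_subset_right.trans (hAs p))]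
          exact measure_mono (inter_subset_inter_left _ inter_subset_left)
  have hle : riemVolume γ ≤ ν := iSup_le fun r => Measure.le_iff.2 (hν r)
  refine (hle s).trans ?_
  rw [Measure.sum_apply _ hs]
  calc ∑' p : S, ((chartVolume γ (p : X)).restrict (A p)) s
      = ∑' p : S, chartVolume γ q (s ∩ A p) := by
        refine tsum_congr fun p => ?_
        rw [Measure.restrict_apply hs, chartVolume_eq γ p q (hs.inter (hA p))
          (inter_subset_right.trans (hAs p)) (inter_subset_left.trans hq)]
    _ = chartVolume γ q (⋃ p : S, s ∩ A p) :=
        (measure_iUnion (fun a b hab => (hd hab).mono inter_subset_right inter_subset_right)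
          fun p => hs.inter (hA p)).symm
    _ ≤ chartVolume γ q s := measure_mono (iUnion_subset fun _ => inter_subset_left)

instance riemVolume_isLocallyFinite [SecondCountableTopology X] (γ : RMetric d X) :
    IsLocallyFiniteMeasure (riemVolume γ) where
  finiteAtNhds q := by
    have : LocallyCompactSpace X := ChartedSpace.locallyCompactSpace (EuclideanSpace ℝ (Fin d)) X
    set y₀ := extChartAt (𝓡 d) q q
    have hy₀ : y₀ ∈ (extChartAt (𝓡 d) q).target := mem_extChartAt_target q
    obtain ⟨K, hK, hy₀K, hKt⟩ := exists_compact_subset (isOpen_extChartAt_target (I := 𝓡 d) q) hy₀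
    have hcont : ContinuousOn (volDensity γ q) K := (continuousOn_volDensity γ q).mono hKt
    obtain ⟨C, hC⟩ := hK.exists_bound_of_continuousOn hcont
    let s : Set X := (extChartAt (𝓡 d) q).source ∩ (extChartAt (𝓡 d) q) ⁻¹' (interior K)
    have hso : IsOpen s :=
      (continuousOn_extChartAt q).isOpen_inter_preimage (isOpen_extChartAt_source q) isOpen_interior
    refine ⟨s, hso.mem_nhds ⟨mem_extChartAt_source q, hy₀K⟩, ?_⟩
    rw [riemVolume_apply γ q hso.measurableSet (by intro p hp; simpa using hp.1),
      chartVolume_apply γ q hso.measurableSet]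
    calc _ ≤ ∫⁻ y in K, ENNReal.ofReal (volDensity γ q y) := by
          refine lintegral_mono_set ?_
          rintro y ⟨hy, hy2⟩
          have := hy2.2
          rw [mem_preimage, (extChartAt (𝓡 d) q).right_inv hy] at this
          exact interior_subset this
      _ ≤ ∫⁻ y in K, ENNReal.ofReal C := by
          refine setLIntegral_mono' hK.measurableSet fun y hy => ?_
          exact ENNReal.ofReal_le_ofReal ((le_abs_self _).trans (hC y hy))
      _ < ⊤ := by
          rw [setLIntegral_const]
          exact ENNReal.mul_lt_top ENNReal.ofReal_lt_top hK.measure_lt_top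

end measure


theorem contMDiff_grad (γ : RMetric d X) {f : X → ℝ} (hf : ContMDiff (𝓡 d) 𝓘(ℝ) ∞ f) :
    ContMDiff (𝓡 d) (𝓡 d).tangent ∞ (fun p => (⟨p, grad γ f p⟩ : TangentBundle (𝓡 d) X)) :=
  contMDiff_sharp γ (contMDiff_mvfderiv hf)

theorem contMDiff_inner (γ : RMetric d X) {V W : ∀ p : X, TangentSpace (𝓡 d) p}
    (hV : ContMDiff (𝓡 d) (𝓡 d).tangent ∞ (fun p => (⟨p, V p⟩ : TangentBundle (𝓡 d) X)))
    (hW : ContMDiff (𝓡 d) (𝓡 d).tangent ∞ (fun p => (⟨p, W p⟩ : TangentBundle (𝓡 d) X))) :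
    ContMDiff (𝓡 d) 𝓘(ℝ) ∞ (fun p => γ.inner p (V p) (W p)) := by
  intro p
  have := ContMDiffAt.clm_bundle_apply₂ (F₁ := EuclideanSpace ℝ (Fin d))
    (F₂ := EuclideanSpace ℝ (Fin d)) (F₃ := ℝ) (E₃ := Bundle.Trivial X ℝ)
    (b := id) (γ.contMDiff p) (hV p) (hW p)
  rw [Bundle.contMDiffAt_totalSpace] at this
  exact this.2

end Riemannian

section Slice
variable {d : ℕ} {X : Type*} [TopologicalSpace X] [ChartedSpace (EuclideanSpace ℝ (Fin d)) X]
  [IsManifold (𝓡 d) ∞ X]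

/-- The geometric data on a slice `X`: Riemannian metric `γ`, lapse `α`, shift `β`. -/
structure SliceData (d : ℕ) (X : Type*) [TopologicalSpace X]
    [ChartedSpace (EuclideanSpace ℝ (Fin d)) X] [IsManifold (𝓡 d) ∞ X] where
  γ : RMetric d X
  α : X → ℝ
  β : ∀ p : X, TangentSpace (𝓡 d) p
  contMDiff_α : ContMDiff (𝓡 d) 𝓘(ℝ) ∞ α
  contMDiff_β : ContMDiff (𝓡 d) (𝓡 d).tangent ∞ (fun p => (⟨p, β p⟩ : TangentBundle (𝓡 d) X))
  α_pos : ∀ p, 0 < α p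
  β_lt : ∀ p, γ.inner p (β p) (β p) < α p ^ 2

/-- `C₀^∞(X)`: the smooth real functions of compact support. -/
def testFn (d : ℕ) (X : Type*) [TopologicalSpace X]
    [ChartedSpace (EuclideanSpace ℝ (Fin d)) X] : Submodule ℝ (X → ℝ) where
  carrier := {f | ContMDiff (𝓡 d) 𝓘(ℝ) ∞ f ∧ HasCompactSupport f}
  add_mem' hf hg := ⟨hf.1.add hg.1, hf.2.add hg.2⟩
  zero_mem' := ⟨contMDiff_const, HasCompactSupport.zero⟩
  smul_mem' c _ hf := ⟨ContMDiff.mul (f := fun _ => c) contMDiff_const hf.1, hf.2.smul_left (f := fun _ => c)⟩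

/-- `C₀^∞(X) ⊕ C₀^∞(X)`, the pairs `(φ, π)`; it will carry the energy norm of `S` and `m`. -/
def InitialData (_S : SliceData d X) (_m : ℝ) : Type _ := testFn d X × testFn d X

namespace InitialData
variable {S : SliceData d X} {m : ℝ}

instance : AddCommGroup (InitialData S m) := inferInstanceAs (AddCommGroup (testFn d X × testFn d X))
instance : Module ℝ (InitialData S m) := inferInstanceAs (Module ℝ (testFn d X × testFn d X))

/-- The field `φ`. -/
def fld (F : InitialData S m) : X → ℝ := F.1.1

/-- The momentum `π`. -/
def mom (F : InitialData S m) : X → ℝ := F.2.1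

/-- `D^a φ + (π / α) β^a`. -/
def vec (F : InitialData S m) (p : X) : TangentSpace (𝓡 d) p :=
  grad S.γ F.fld p + (F.mom p / S.α p) • S.β p

/-- The integrand of the (polarized) energy form, `2H(F) = ∫ energyDensity F F dγ`. -/
def energyDensity (F G : InitialData S m) (p : X) : ℝ :=
  S.α p * ((1 - S.γ.inner p (S.β p) (S.β p) / S.α p ^ 2) * (F.mom p * G.mom p)
    + S.γ.inner p (F.vec p) (G.vec p) + m ^ 2 * (F.fld p * G.fld p))

theorem contMDiff_fld (F : InitialData S m) : ContMDiff (𝓡 d) 𝓘(ℝ) ∞ F.fld := F.1.2.1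
theorem contMDiff_mom (F : InitialData S m) : ContMDiff (𝓡 d) 𝓘(ℝ) ∞ F.mom := F.2.2.1

theorem contMDiff_vec (F : InitialData S m) :
    ContMDiff (𝓡 d) (𝓡 d).tangent ∞ (fun p => (⟨p, F.vec p⟩ : TangentBundle (𝓡 d) X)) :=
  (contMDiff_grad S.γ F.contMDiff_fld).add_section
    ((F.contMDiff_mom.div₀ S.contMDiff_α fun p => (S.α_pos p).ne').smul_section S.contMDiff_β)

theorem continuous_energyDensity (F G : InitialData S m) : Continuous (energyDensity F G) := by
  have h1 := (contMDiff_inner S.γ F.contMDiff_vec G.contMDiff_vec).continuous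
  have h2 := (contMDiff_inner S.γ S.contMDiff_β S.contMDiff_β).continuous
  have h3 := S.contMDiff_α.continuous
  have h4 : Continuous fun p => S.γ.inner p (S.β p) (S.β p) / S.α p ^ 2 :=
    h2.div (h3.pow 2) fun p => (pow_pos (S.α_pos p) 2).ne'
  exact h3.mul ((((continuous_const.sub h4).mul
    (F.contMDiff_mom.continuous.mul G.contMDiff_mom.continuous)).add h1).add
    (continuous_const.mul (F.contMDiff_fld.continuous.mul G.contMDiff_fld.continuous)))

theorem hasCompactSupport_energyDensity [T2Space X] (F G : InitialData S m) :
    HasCompactSupport (energyDensity F G) := by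
  refine HasCompactSupport.intro (F.1.2.2.isCompact.union F.2.2.2.isCompact) fun p hp => ?_
  have h1 : p ∉ tsupport F.fld := fun h => hp (Or.inl h)
  have h2 : p ∉ tsupport F.mom := fun h => hp (Or.inr h)
  have h3 : F.fld p = 0 := image_eq_zero_of_notMem_tsupport h1
  have h4 : F.mom p = 0 := image_eq_zero_of_notMem_tsupport h2
  have h5 : mvfderiv (𝓡 d) F.fld p = 0 := by
    have : F.fld =ᶠ[𝓝 p] fun _ => (0 : ℝ) := notMem_tsupport_iff_eventuallyEq.1 h1
    rw [mvfderiv, this.mfderiv_eq, mfderiv_const]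
    rfl
  have h6 : F.vec p = 0 := by
    simp [vec, grad, sharp, h4, h5]
  simp [energyDensity, h3, h4, h6]

theorem vec_add (F G : InitialData S m) (p : X) : (F + G).vec p = F.vec p + G.vec p := by
  have h : mvfderiv (𝓡 d) (F + G).fld p = mvfderiv (𝓡 d) F.fld p + mvfderiv (𝓡 d) G.fld p :=
    mvfderiv_add (F.contMDiff_fld.mdifferentiableAt (by simp))
      (G.contMDiff_fld.mdifferentiableAt (by simp))
  have h' : (F + G).mom p = F.mom p + G.mom p := rfl
  simp only [vec, grad, sharp, h, h', map_add, add_div, add_smul]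
  abel

theorem vec_smul (c : ℝ) (F : InitialData S m) (p : X) : (c • F).vec p = c • F.vec p := by
  have h : mvfderiv (𝓡 d) (c • F).fld p = c • mvfderiv (𝓡 d) F.fld p := by
    have := mvfderiv_smul (a := fun _ => c) (x := p) mdifferentiableAt_const
      (F.contMDiff_fld.mdifferentiableAt (n := ∞) (by simp))
    rw [mvfderiv_const] at this
    refine Eq.trans this ?_
    ext v
    simp
  have h' : (c • F).mom p = c * F.mom p := rfl
  simp only [vec, grad, sharp, h, h', map_smul, mul_div_assoc, mul_smul, smul_add]

variable [T2Space X] [SecondCountableTopology X] [MeasurableSpace X] [BorelSpace X]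

theorem integrable_energyDensity (F G : InitialData S m) :
    Integrable (energyDensity F G) (riemVolume S.γ) :=
  (continuous_energyDensity F G).integrable_of_hasCompactSupport
    (hasCompactSupport_energyDensity F G)

/-- The energy form `⟨F, G⟩ = ∫ α ([1 - β²/α²] π π' + γ_ab v^a v'^b + m² φ φ') dγ`,
with `v = Dφ + (π/α) β`. -/
instance energyCore : PreInnerProductSpace.Core ℝ (InitialData S m) where
  inner F G := ∫ p, energyDensity F G p ∂(riemVolume S.γ)
  conj_inner_symm F G := by
    simp only [conj_trivial]
    refine integral_congr_ae (Filter.Eventually.of_forall fun p => ?_)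
    simp only [energyDensity, S.γ.symm p (G.vec p) (F.vec p)]
    ring
  re_inner_nonneg F := by
    simp only [RCLike.re_to_real]
    refine integral_nonneg fun p => ?_
    have h0 := S.α_pos p
    have h1 : S.γ.inner p (S.β p) (S.β p) / S.α p ^ 2 ≤ 1 :=
      (div_le_one (pow_pos h0 2)).2 (S.β_lt p).le
    have h2 : 0 ≤ S.γ.inner p (F.vec p) (F.vec p) := by
      by_cases h : F.vec p = 0
      · simp [h]
      · exact (S.γ.pos p _ h).le
    have h3 : 0 ≤ (1 - S.γ.inner p (S.β p) (S.β p) / S.α p ^ 2) * (F.mom p * F.mom p) :=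
      mul_nonneg (sub_nonneg.2 h1) (mul_self_nonneg _)
    have h4 : 0 ≤ m ^ 2 * (F.fld p * F.fld p) := mul_nonneg (sq_nonneg _) (mul_self_nonneg _)
    exact mul_nonneg h0.le (by linarith)
  add_left F F' G := by
    rw [← integral_add (integrable_energyDensity F G) (integrable_energyDensity F' G)]
    refine integral_congr_ae (Filter.Eventually.of_forall fun p => ?_)
    have h1 : (F + F').fld p = F.fld p + F'.fld p := rfl
    have h2 : (F + F').mom p = F.mom p + F'.mom p := rfl
    simp only [energyDensity, vec_add, h1, h2, map_add, add_apply]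
    ring
  smul_left F G c := by
    simp only [conj_trivial]
    rw [← integral_const_mul]
    refine integral_congr_ae (Filter.Eventually.of_forall fun p => ?_)
    have h1 : (c • F).fld p = c * F.fld p := rfl
    have h2 : (c • F).mom p = c * F.mom p := rfl
    simp only [energyDensity, vec_smul, h1, h2, map_smul, smul_apply, smul_eq_mul]
    ring

/-- The energy norm, `‖F‖² = 2H(F)`. -/
instance : SeminormedAddCommGroup (InitialData S m) :=
  InnerProductSpace.Core.toSeminormedAddCommGroup (𝕜 := ℝ)

instance : InnerProductSpace ℝ (InitialData S m) := InnerProductSpace.ofCore energyCore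

end InitialData

variable [T2Space X] [SecondCountableTopology X] [MeasurableSpace X] [BorelSpace X]

/-- The Hilbert space `H_A`: the completion of `C₀^∞(X) ⊕ C₀^∞(X)` in the energy norm. -/
abbrev EnergySpace (S : SliceData d X) (m : ℝ) : Type _ :=
  UniformSpace.Completion (InitialData S m)

/-! ### The operators on the slice -/

/-- The matrix differential operator
`𝒜 (φ, π) = (-(D^a α) D_a φ + α (m² - D^a D_a) φ - (D_a β^a) π - β^a D_a π, β^a D_a φ + α π)`. -/
def opA (S : SliceData d X) (m : ℝ) (u : (X → ℝ) × (X → ℝ)) : (X → ℝ) × (X → ℝ) :=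
  (fun p => -(mvfderiv (𝓡 d) u.1 p (grad S.γ S.α p))
      + S.α p * (m ^ 2 * u.1 p - laplacian S.γ u.1 p)
      - divergence S.γ S.β p * u.2 p - mvfderiv (𝓡 d) u.2 p (S.β p),
    fun p => mvfderiv (𝓡 d) u.1 p (S.β p) + S.α p * u.2 p)

/-- The symplectic matrix `j (φ, π) = (π, -φ)`. -/
def opJ (u : (X → ℝ) × (X → ℝ)) : (X → ℝ) × (X → ℝ) := (u.2, -u.1)

/-- The time-evolution operator `h = -j 𝒜`. -/
def opH (S : SliceData d X) (m : ℝ) (u : (X → ℝ) × (X → ℝ)) : (X → ℝ) × (X → ℝ) :=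
  -opJ (opA S m u)

/-- The symplectic form `σ(F, G) = ⟨F, j G⟩` of `L²(dγ) ⊕ L²(dγ)`, on smooth data of compact
support. -/
def sigma {S : SliceData d X} {m : ℝ} (F G : InitialData S m) : ℝ :=
  ∫ p, (F.fld p * (opJ (G.fld, G.mom)).1 p + F.mom p * (opJ (G.fld, G.mom)).2 p) ∂(riemVolume S.γ)

/-- The operator `A` on `H_A` extends `h`: for all `F` in `C₀^∞ ⊕ C₀^∞`, the pair `h F` is again in
`C₀^∞ ⊕ C₀^∞`, `F` is in the domain of `A`, and `A F = h F`. -/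
def ExtendsH {S : SliceData d X} {m : ℝ} (A : EnergySpace S m →ₗ.[ℝ] EnergySpace S m) : Prop :=
  ∀ F : InitialData S m, ∃ G : InitialData S m, (G.fld, G.mom) = opH S m (F.fld, F.mom) ∧
    ((F : EnergySpace S m), (G : EnergySpace S m)) ∈ A.graph

end Slice

section Spacetime
variable {d : ℕ} {M : Type*} [TopologicalSpace M]
  [ChartedSpace (EuclideanSpace ℝ (Fin (d + 1))) M] [IsManifold (𝓡 (d + 1)) ∞ M]
  {X : Type*} [TopologicalSpace X] [ChartedSpace (EuclideanSpace ℝ (Fin d)) X]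
  [IsManifold (𝓡 d) ∞ X]

/-- A stationary spacetime: a smooth Lorentzian metric `g` of signature `(-, +, …, +)` with an
everywhere timelike Killing field `K` whose orbits are complete, i.e. which generates a
one-parameter group `flow` of isometries. Time is oriented so that `K` is future directed. -/
structure StationarySpacetime (d : ℕ) (M : Type*) [TopologicalSpace M]
    [ChartedSpace (EuclideanSpace ℝ (Fin (d + 1))) M] [IsManifold (𝓡 (d + 1)) ∞ M] where
  g : ∀ x : M, TangentSpace (𝓡 (d + 1)) x →L[ℝ] TangentSpace (𝓡 (d + 1)) x →L[ℝ] ℝ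
  symm : ∀ x v w, g x v w = g x w v
  lorentzian : ∀ x, ∃ v, g x v v < 0 ∧ ∀ w, w ≠ 0 → g x v w = 0 → 0 < g x w w
  contMDiff_g : ContMDiff (𝓡 (d + 1)) ((𝓡 (d + 1)).prod 𝓘(ℝ, EuclideanSpace ℝ (Fin (d + 1)) →L[ℝ]
      EuclideanSpace ℝ (Fin (d + 1)) →L[ℝ] ℝ)) ∞
    (fun x => TotalSpace.mk' (EuclideanSpace ℝ (Fin (d + 1)) →L[ℝ]
      EuclideanSpace ℝ (Fin (d + 1)) →L[ℝ] ℝ) x (g x))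
  K : ∀ x : M, TangentSpace (𝓡 (d + 1)) x
  contMDiff_K : ContMDiff (𝓡 (d + 1)) (𝓡 (d + 1)).tangent ∞
    (fun x => (⟨x, K x⟩ : TangentBundle (𝓡 (d + 1)) M))
  timelike : ∀ x, g x (K x) (K x) < 0
  flow : ℝ → M → M
  contMDiff_flow : ContMDiff (𝓘(ℝ).prod (𝓡 (d + 1))) (𝓡 (d + 1)) ∞
    (fun z : ℝ × M => flow z.1 z.2)
  flow_zero : ∀ x, flow 0 x = x
  flow_add : ∀ s t x, flow (s + t) x = flow s (flow t x)
  isMIntegralCurve_flow : ∀ x, IsMIntegralCurve (fun t => flow t x) K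
  isometry_flow : ∀ t x v w, g (flow t x) (mfderiv (𝓡 (d + 1)) (𝓡 (d + 1)) (flow t) x v)
    (mfderiv (𝓡 (d + 1)) (𝓡 (d + 1)) (flow t) x w) = g x v w

/-- A smoothly embedded spatial hypersurface `Σ₀ = ι(X)` that meets each orbit of the Killing
field exactly once. Its translates `Σ_t = flow t (ι(X))` then foliate `M`. -/
structure SpatialSlice (N : StationarySpacetime d M) (X : Type*) [TopologicalSpace X]
    [ChartedSpace (EuclideanSpace ℝ (Fin d)) X] [IsManifold (𝓡 d) ∞ X] where
  ι : X → M
  isSmoothEmbedding : IsSmoothEmbedding (𝓡 d) (𝓡 (d + 1)) ∞ ι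
  spacelike : ∀ (p : X) (v : TangentSpace (𝓡 d) p), v ≠ 0 →
    0 < N.g (ι p) (mfderiv (𝓡 d) (𝓡 (d + 1)) ι p v) (mfderiv (𝓡 d) (𝓡 (d + 1)) ι p v)
  orbits : Function.Bijective (fun z : ℝ × X => N.flow z.1 (ι z.2))

theorem isVonNBounded_of_pos {p : X} (B : TangentSpace (𝓡 d) p →L[ℝ] TangentSpace (𝓡 d) p →L[ℝ] ℝ)
    (hB : ∀ v, v ≠ 0 → 0 < B v v) :
    Bornology.IsVonNBounded ℝ {v : TangentSpace (𝓡 d) p | B v v < 1} := by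
  change Bornology.IsVonNBounded ℝ (E := EuclideanSpace ℝ (Fin d))
    {v : EuclideanSpace ℝ (Fin d) | B v v < 1}
  let B' : EuclideanSpace ℝ (Fin d) →L[ℝ] EuclideanSpace ℝ (Fin d) →L[ℝ] ℝ := B
  change Bornology.IsVonNBounded ℝ (E := EuclideanSpace ℝ (Fin d))
    {v : EuclideanSpace ℝ (Fin d) | B' v v < 1}
  have hB' : ∀ v, v ≠ 0 → 0 < B' v v := hB
  clear_value B'
  rw [NormedSpace.isVonNBounded_iff]
  have hc : Continuous fun v => B' v v := by fun_prop
  obtain ⟨c, hc0, hcB⟩ : ∃ c : ℝ, 0 < c ∧ ∀ v, ‖v‖ = 1 → c ≤ B' v v := by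
    rcases (Metric.sphere (0 : EuclideanSpace ℝ (Fin d)) 1).eq_empty_or_nonempty with h | h
    · refine ⟨1, one_pos, fun v hv => ?_⟩
      have : v ∈ Metric.sphere (0 : EuclideanSpace ℝ (Fin d)) 1 := by simpa using hv
      rw [h] at this
      exact this.elim
    · obtain ⟨v, hv, hmin⟩ := (isCompact_sphere (0 : EuclideanSpace ℝ (Fin d)) 1).exists_isMinOn h
        hc.continuousOn
      refine ⟨B' v v, hB' v ?_, fun w hw => hmin (by simpa using hw)⟩
      rintro rfl
      simp at hv
  refine (Metric.isBounded_iff_subset_closedBall 0).2 ⟨Real.sqrt (1 / c), fun v hv => ?_⟩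
  rw [mem_closedBall_zero_iff]
  by_cases h0 : v = 0
  · simp [h0]
  have hn : 0 < ‖v‖ := norm_pos_iff.2 h0
  have h1 := hcB (‖v‖⁻¹ • v) (by rw [norm_smul, norm_inv, norm_norm, inv_mul_cancel₀ hn.ne'])
  simp only [map_smul, smul_apply, smul_eq_mul] at h1
  have hv' : B' v v < 1 := hv
  refine Real.le_sqrt_of_sq_le ?_
  rw [le_div_iff₀ hc0]
  have h2 : c * ‖v‖ ^ 2 ≤ B' v v := by
    have := mul_le_mul_of_nonneg_right h1 (sq_nonneg ‖v‖)
    refine this.trans_eq ?_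
    field_simp
  linarith

namespace SpatialSlice
variable {N : StationarySpacetime d M} (C : SpatialSlice N X)

/-- The differential of the embedding. -/
def dι (p : X) : TangentSpace (𝓡 d) p →L[ℝ] TangentSpace (𝓡 (d + 1)) (C.ι p) :=
  mfderiv (𝓡 d) (𝓡 (d + 1)) C.ι p

theorem contMDiff_dι_apply {V : ∀ p : X, TangentSpace (𝓡 d) p} {s : Set X} 
    (hV : ContMDiffOn (𝓡 d) (𝓡 d).tangent ∞ (fun p => (⟨p, V p⟩ : TangentBundle (𝓡 d) X)) s) :
    ContMDiffOn (𝓡 d) (𝓡 (d + 1)).tangent ∞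
      (fun p => (⟨C.ι p, C.dι p (V p)⟩ : TangentBundle (𝓡 (d + 1)) M)) s :=
  (C.isSmoothEmbedding.contMDiff.contMDiff_tangentMap (m := ∞) (by simp)).comp_contMDiffOn hV

theorem contMDiff_g_apply {V W : ∀ p : X, TangentSpace (𝓡 (d + 1)) (C.ι p)} {s : Set X} 
    (hV : ContMDiffOn (𝓡 d) (𝓡 (d + 1)).tangent ∞
      (fun p => (⟨C.ι p, V p⟩ : TangentBundle (𝓡 (d + 1)) M)) s)
    (hW : ContMDiffOn (𝓡 d) (𝓡 (d + 1)).tangent ∞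
      (fun p => (⟨C.ι p, W p⟩ : TangentBundle (𝓡 (d + 1)) M)) s) :
    ContMDiffOn (𝓡 d) 𝓘(ℝ) ∞ (fun p => N.g (C.ι p) (V p) (W p)) s := by
  intro p hp
  have := ContMDiffWithinAt.clm_bundle_apply₂ (F₁ := EuclideanSpace ℝ (Fin (d + 1)))
    (F₂ := EuclideanSpace ℝ (Fin (d + 1))) (F₃ := ℝ) (E₃ := Bundle.Trivial M ℝ)
    (b := C.ι) (((N.contMDiff_g _).comp p (C.isSmoothEmbedding.contMDiff p)).contMDiffWithinAt)
      (hV p hp) (hW p hp)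
  rw [Bundle.contMDiffWithinAt_totalSpace] at this
  exact this.2

/-- The pullback `ι^* g` at a point. -/
def pullback (p : X) : TangentSpace (𝓡 d) p →L[ℝ] TangentSpace (𝓡 d) p →L[ℝ] ℝ :=
  (ContinuousLinearMap.precomp ℝ (C.dι p)) ∘L (N.g (C.ι p)) ∘L (C.dι p)

theorem pullback_apply (p : X) (v w : TangentSpace (𝓡 d) p) :
    C.pullback p v w = N.g (C.ι p) (C.dι p v) (C.dι p w) := rfl

theorem pullback_pos (p : X) (v : TangentSpace (𝓡 d) p) (hv : v ≠ 0) : 0 < C.pullback p v v :=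
  C.spacelike p v hv

/-- The Riemannian metric `γ = ι^* g` induced on the slice. -/
def inducedMetric : RMetric d X where
  inner := C.pullback
  symm _ _ _ := N.symm _ _ _
  pos := C.pullback_pos
  isVonNBounded p := isVonNBounded_of_pos (C.pullback p) (C.pullback_pos p)
  contMDiff := contMDiff_bilin fun q v w =>
    C.contMDiff_g_apply (C.contMDiff_dι_apply (contMDiffOn_frame q v))
      (C.contMDiff_dι_apply (contMDiffOn_frame q w))

/-- The covector `β_a`, the restriction of `g(K, ·)` to the slice. -/
def shiftCovector (p : X) : TangentSpace (𝓡 d) p →L[ℝ] ℝ :=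
  N.g (C.ι p) (N.K (C.ι p)) ∘L C.dι p

/-- The shift vector `β`, the projection of `K` to the slice. -/
def shift (p : X) : TangentSpace (𝓡 d) p := sharp C.inducedMetric p (C.shiftCovector p)

/-- The lapse `α`, with `-α² + β² = g(K, K)`. -/
def lapse (p : X) : ℝ :=
  Real.sqrt (C.inducedMetric.inner p (C.shift p) (C.shift p) - N.g (C.ι p) (N.K (C.ι p)) (N.K (C.ι p)))

/-- The unit normal `n` of the slice. -/
def normal (p : X) : TangentSpace (𝓡 (d + 1)) (C.ι p) :=
  (C.lapse p)⁻¹ • (N.K (C.ι p) - C.dι p (C.shift p))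

theorem inner_shift_nonneg (p : X) : 0 ≤ C.inducedMetric.inner p (C.shift p) (C.shift p) := by
  by_cases h : C.shift p = 0
  · simp [h]
  · exact (C.inducedMetric.pos p _ h).le

theorem lapse_pos (p : X) : 0 < C.lapse p :=
  Real.sqrt_pos.2 (by linarith [C.inner_shift_nonneg p, N.timelike (C.ι p)])

theorem lapse_sq (p : X) : C.lapse p ^ 2 =
    C.inducedMetric.inner p (C.shift p) (C.shift p) - N.g (C.ι p) (N.K (C.ι p)) (N.K (C.ι p)) :=
  Real.sq_sqrt (by linarith [C.inner_shift_nonneg p, N.timelike (C.ι p)])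

theorem g_K_dι (p : X) (v : TangentSpace (𝓡 d) p) :
    N.g (C.ι p) (N.K (C.ι p)) (C.dι p v) = N.g (C.ι p) (C.dι p (C.shift p)) (C.dι p v) :=
  (congrArg (fun l => l v) (inner_sharp C.inducedMetric p (C.shiftCovector p))).symm

/-- Lapse and shift are the ones of the decomposition `K = α n + β`, where `n` is the
future-directed unit normal and `β` is tangent to the slice. -/
theorem lapse_shift_spec (p : X) :
    N.K (C.ι p) = C.lapse p • C.normal p + C.dι p (C.shift p) ∧
    N.g (C.ι p) (C.normal p) (C.normal p) = -1 ∧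
    (∀ v, N.g (C.ι p) (C.normal p) (C.dι p v) = 0) ∧
    N.g (C.ι p) (C.normal p) (N.K (C.ι p)) < 0 := by
  have ha := C.lapse_pos p
  have hsq := C.lapse_sq p
  have hin : C.inducedMetric.inner p (C.shift p) (C.shift p) =
    N.g (C.ι p) (C.dι p (C.shift p)) (C.dι p (C.shift p)) := rfl
  have hK := C.g_K_dι p
  have hK' := hK (C.shift p)
  have hs := N.symm (C.ι p) (C.dι p (C.shift p)) (N.K (C.ι p))
  rw [hin] at hsq
  refine ⟨?_, ?_, ?_, ?_⟩
  · simp [normal, smul_smul, mul_inv_cancel₀ ha.ne']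
  · simp only [normal, map_smul, map_sub, smul_apply, sub_apply, smul_eq_mul]
    field_simp
    linarith
  · intro v
    simp [normal, hK v]
  · simp only [normal, map_smul, map_sub, smul_apply, sub_apply, smul_eq_mul]
    refine mul_neg_of_pos_of_neg (inv_pos.2 ha) ?_
    have := pow_pos ha 2
    linarith

theorem contMDiff_shift : ContMDiff (𝓡 d) (𝓡 d).tangent ∞
    (fun p => (⟨p, C.shift p⟩ : TangentBundle (𝓡 d) X)) :=
  contMDiff_sharp _ (contMDiff_covector fun q v => C.contMDiff_g_apply
    ((N.contMDiff_K.comp C.isSmoothEmbedding.contMDiff).contMDiffOn)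
    (C.contMDiff_dι_apply (contMDiffOn_frame q v)))

theorem contMDiff_lapse : ContMDiff (𝓡 d) 𝓘(ℝ) ∞ C.lapse := by
  have h1 := contMDiff_inner C.inducedMetric C.contMDiff_shift C.contMDiff_shift
  have h2 : ContMDiff (𝓡 d) 𝓘(ℝ) ∞ fun p => N.g (C.ι p) (N.K (C.ι p)) (N.K (C.ι p)) := by
    have := (N.contMDiff_K.comp C.isSmoothEmbedding.contMDiff).contMDiffOn (s := univ)
    exact contMDiffOn_univ.1 (C.contMDiff_g_apply this this)
  intro p
  have h3 := (h1.sub h2) p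
  refine ContMDiffAt.comp (I' := 𝓘(ℝ)) p (g := Real.sqrt) ?_ h3
  refine (Real.contDiffAt_sqrt ?_).contMDiffAt
  have := C.lapse_sq p
  exact (this ▸ pow_pos (C.lapse_pos p) 2).ne'

/-- The metric, lapse and shift induced on the slice. -/
def data : SliceData d X where
  γ := C.inducedMetric
  α := C.lapse
  β := C.shift
  contMDiff_α := C.contMDiff_lapse
  contMDiff_β := C.contMDiff_shift
  α_pos := C.lapse_pos
  β_lt p := by linarith [C.lapse_sq p, N.timelike (C.ι p)]

end SpatialSlice
end Spacetime

section Operators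
variable {H : Type*} [NormedAddCommGroup H] [InnerProductSpace ℝ H] [CompleteSpace H]

/-- A densely defined operator `A` is skew-adjoint if `A† = -A` (with equal domains). -/
def IsSkewAdjointOp (A : H →ₗ.[ℝ] H) : Prop :=
  Dense (A.domain : Set H) ∧ A.adjoint = -A

/-- `U t = e^{-At}`: the strongly continuous one-parameter group of isometries whose generator
is exactly `-A`. -/
structure IsEvolution (A : H →ₗ.[ℝ] H) (U : ℝ → H →L[ℝ] H) : Prop where
  zero : ∀ Φ, U 0 Φ = Φ
  add : ∀ s t Φ, U (s + t) Φ = U s (U t Φ)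
  norm_map : ∀ t Φ, ‖U t Φ‖ = ‖Φ‖
  continuous : ∀ Φ, Continuous fun t => U t Φ
  generator : ∀ Φ Ψ, HasDerivAt (fun t => U t Φ) (-Ψ) 0 ↔ (Φ, Ψ) ∈ A.graph

end Operators
end StationaryKG
end

noncomputable section
namespace StationaryKG

/-! ### Unbounded inverses of bounded skew-adjoint operators and their bounded approximations. -/

section InverseOperator
variable {H : Type*} [NormedAddCommGroup H] [InnerProductSpace ℝ H] [CompleteSpace H]

/-! ### Inverses of bounded skew-adjoint operators -/

/-! The energy inner product and the symplectic form determine each other through `h`: on smooth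
data of compact support, `⟨G, F⟩ = σ(G, h F)` (`sigma_hData`). The two integrands differ by the
divergences of two compactly supported vector fields. So instead of extending `h` directly, one
inverts it: `σ` is represented on the energy space by a bounded operator `T`, and `T` turns out to
be a left inverse of `h`.

Boundedness of `σ` is the only place where the mass and the bound on the shift are used. The energy
density dominates `ε (π² + m² φ²)` (`le_energyDensity`), so `σ` is continuous in the energy norm and
extends to the completion (`exists_sigma_extension`). The Riesz representation gives `T`, and
antisymmetry of `σ` gives `T* = -T`. From `⟨G, T h F⟩ = σ(G, h F) = ⟨G, F⟩` for all smooth `G` and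
density, `T h F = F`. Thus the range of `T` contains all smooth data and is dense; the kernel, being
its orthogonal complement, is zero. The inverse of an injective skew-adjoint operator with dense
range is skew-adjoint (`isSkewAdjointOp_inverseOp`), and `T h F = F` says that this inverse extends
`h`. No completeness of the slice is used, and no essential skew-adjointness of `h`.

The group is built from the bounded skew-adjoint operators `B_s = T (T² - s)⁻¹`, which commute with
each other and with `T` and satisfy `B_s T y → y` as `s → 0`. Their exponentials are isometries, and
by commutation `‖exp(tB)x - exp(tB')x‖ ≤ |t| ‖Bx - B'x‖`, so they converge strongly, first on the
range of `T` and then everywhere. The limit group is isometric and commutes with `T`; since `σ(Φ, Ψ)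
= ⟨Φ, TΨ⟩`, it conserves `σ`.

The geometric input is the divergence theorem on the slice (`integral_mul_divergence`). The
divergence at a point is defined in the chart centred there, so its independence of the chart is
proved first (`chartDiv_eq`), by a weak argument: integration by parts characterises it without
reference to a chart. -/

theorem inner_skew {T : H →L[ℝ] H} (hT : ContinuousLinearMap.adjoint T = -T) (x y : H) :
    inner ℝ (T x) y = -inner ℝ x (T y) := by
  rw [← ContinuousLinearMap.adjoint_inner_right, hT]
  simp

/-- The kernel of `T` is orthogonal to the range of `T* = -T`, which is dense. -/
theorem injective_of_skew {T : H →L[ℝ] H} (hT : ContinuousLinearMap.adjoint T = -T)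
    (hd : DenseRange T) : Function.Injective T := by
  rw [injective_iff_map_eq_zero]
  intro x hx
  refine Dense.eq_zero_of_inner_left ℝ hd fun y hy => ?_
  obtain ⟨z, rfl⟩ := hy
  rw [← neg_inj, ← inner_skew hT, hx]
  simp

/-- The operator `T⁻¹` with domain the range of `T`. -/
def inverseOp (T : H →L[ℝ] H) : H →ₗ.[ℝ] H := (T.toLinearMap.toPMap ⊤).inverse

theorem mem_graph_inverseOp {T : H →L[ℝ] H} (hT : Function.Injective T) (x y : H) :
    (x, y) ∈ (inverseOp T).graph ↔ T y = x := by
  rw [inverseOp, LinearPMap.inverse_graph]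
  · simp [LinearPMap.mem_graph_iff]
  · rw [LinearMap.ker_eq_bot]
    intro a b h
    exact Subtype.ext (hT h)

theorem mem_domain_inverseOp {T : H →L[ℝ] H} (hT : Function.Injective T) (x : H) :
    x ∈ (inverseOp T).domain ↔ x ∈ range T := by
  rw [LinearPMap.mem_domain_iff]
  simp [mem_graph_inverseOp hT]

/-- The graph of the inverse consists of the pairs `(T v, v)`, so `(x, y)` lies in the graph of the
adjoint iff `⟨v, x⟩ = ⟨T v, y⟩ = ⟨v, -T y⟩` for every `v`, that is, iff `x = T (-y)`. As `v` ranges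
over the whole space, equality of the domains comes for free. -/
theorem isSkewAdjointOp_inverseOp {T : H →L[ℝ] H} (hT : ContinuousLinearMap.adjoint T = -T)
    (hd : DenseRange T) : IsSkewAdjointOp (inverseOp T) := by
  have hi := injective_of_skew hT hd
  have hdom : Dense ((inverseOp T).domain : Set H) := by
    have : ((inverseOp T).domain : Set H) = range T := by
      ext x; exact mem_domain_inverseOp hi x
    rw [this]
    exact hd
  refine ⟨hdom, LinearPMap.eq_of_eq_graph ?_⟩
  ext ⟨x, y⟩
  rw [LinearPMap.adjoint_graph_eq_graph_adjoint hdom, Submodule.mem_adjoint_iff]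
  have h1 : (x, y) ∈ (-inverseOp T).graph ↔ T (-y) = x := by
    rw [← mem_graph_inverseOp hi, LinearPMap.neg_graph]
    simp [LinearPMap.mem_graph_iff, neg_eq_iff_eq_neg]
  rw [h1]
  simp only [mem_graph_inverseOp hi]
  constructor
  · intro h
    refine ext_inner_left ℝ fun v => ?_
    have := h (T v) v rfl
    rw [inner_skew hT] at this
    simp only [map_neg, inner_neg_right]
    linarith
  · rintro rfl a b rfl
    rw [inner_skew hT]
    simp

theorem commute_ringInverse {R : Type*} [Ring R] {a b : R} (hb : IsUnit b) (h : Commute a b) :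
    Commute a (Ring.inverse b) := by
  obtain ⟨u, rfl⟩ := hb
  rw [Ring.inverse_unit]
  exact h.units_inv_right

/-! ### The Yosida approximations of the inverse -/

/-- Since `-T² = T* T ≥ 0`, the operator is coercive with constant `s`. -/
theorem isUnit_yosida {T : H →L[ℝ] H} (hT : ContinuousLinearMap.adjoint T = -T) {s : ℝ}
    (hs : 0 < s) : IsUnit (s • (1 : H →L[ℝ] H) - T * T) := by
  refine ContinuousLinearMap.isUnit_of_forall_le_norm_inner_map _ (c := ⟨s, hs.le⟩) hs fun x => ?_
  refine le_trans ?_ (le_abs_self _)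
  have : inner ℝ ((s • (1 : H →L[ℝ] H) - T * T) x) x = s * ‖x‖ ^ 2 + ‖T x‖ ^ 2 := by
    simp [inner_sub_left, inner_smul_left, inner_skew hT (T x) x]
  rw [this]
  change ‖x‖ ^ 2 * s ≤ _
  nlinarith [sq_nonneg ‖T x‖]

/-- `(s - T²)⁻¹`. -/
def yosidaRes (T : H →L[ℝ] H) (s : ℝ) : H →L[ℝ] H := Ring.inverse (s • (1 : H →L[ℝ] H) - T * T)

/-- The bounded skew-adjoint operator `T (T² - s)⁻¹`, which approximates `T⁻¹` as `s → 0`. -/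
def yosida (T : H →L[ℝ] H) (s : ℝ) : H →L[ℝ] H := -(T * yosidaRes T s)

theorem yosidaRes_spec {T : H →L[ℝ] H} (hT : ContinuousLinearMap.adjoint T = -T) {s : ℝ}
    (hs : 0 < s) (x : H) :
    s • yosidaRes T s x - T (T (yosidaRes T s x)) = x := by
  have := Ring.mul_inverse_cancel _ (isUnit_yosida hT hs)
  exact congrArg (fun f : H →L[ℝ] H => f x) this

theorem yosidaRes_commute {T : H →L[ℝ] H} (hT : ContinuousLinearMap.adjoint T = -T) {s : ℝ}
    (hs : 0 < s) : Commute T (yosidaRes T s) := by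
  have h : Commute T (s • (1 : H →L[ℝ] H) - T * T) := by
    refine Commute.sub_right ?_ ((Commute.refl T).mul_right (Commute.refl T))
    exact (Commute.one_right T).smul_right s
  exact commute_ringInverse (isUnit_yosida hT hs) h

/-- Pairing `s w - T² w = z` with `w` gives this identity, from which both resolvent bounds below
follow by Cauchy–Schwarz. -/
theorem inner_yosidaRes {T : H →L[ℝ] H} (hT : ContinuousLinearMap.adjoint T = -T) {s : ℝ}
    (hs : 0 < s) (z : H) : inner ℝ (yosidaRes T s z) z =
    s * ‖yosidaRes T s z‖ ^ 2 + ‖T (yosidaRes T s z)‖ ^ 2 := by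
  have h := yosidaRes_spec hT hs z
  have h' := inner_skew hT (yosidaRes T s z) (T (yosidaRes T s z))
  rw [real_inner_self_eq_norm_sq] at h'
  generalize yosidaRes T s z = w at *
  rw [← h, inner_sub_right, inner_smul_right, real_inner_self_eq_norm_sq]
  linarith

theorem norm_smul_yosidaRes_le {T : H →L[ℝ] H} (hT : ContinuousLinearMap.adjoint T = -T) {s : ℝ}
    (hs : 0 < s) (z : H) : s * ‖yosidaRes T s z‖ ≤ ‖z‖ := by
  have h1 := inner_yosidaRes hT hs z
  have h2 := real_inner_le_norm (yosidaRes T s z) z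
  rcases (norm_nonneg (yosidaRes T s z)).eq_or_lt with h | h
  · rw [← h]; simp
  · refine le_of_mul_le_mul_left ?_ h
    nlinarith [sq_nonneg ‖T (yosidaRes T s z)‖]

/-- With `w = (s - T²)⁻¹ z`, the identity gives `‖T w‖² ≤ ‖w‖ ‖z‖ ≤ ‖z‖² / s`. The resulting factor
`√s` makes the error of the approximation vanish on the range of `T` as `s → 0`. -/
theorem norm_smul_yosidaRes_apply_le {T : H →L[ℝ] H} (hT : ContinuousLinearMap.adjoint T = -T)
    {s : ℝ} (hs : 0 < s) (z : H) : s * ‖yosidaRes T s (T z)‖ ≤ Real.sqrt s * ‖z‖ := by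
  have hc : yosidaRes T s (T z) = T (yosidaRes T s z) :=
    (congrArg (fun f : H →L[ℝ] H => f z) (yosidaRes_commute hT hs).eq).symm
  have h1 := inner_yosidaRes hT hs z
  have h2 := real_inner_le_norm (yosidaRes T s z) z
  have h3 := norm_smul_yosidaRes_le hT hs z
  rw [hc]
  have h4 : s * ‖T (yosidaRes T s z)‖ ^ 2 ≤ ‖z‖ ^ 2 := by
    have h5 : ‖T (yosidaRes T s z)‖ ^ 2 ≤ ‖yosidaRes T s z‖ * ‖z‖ := by
      nlinarith [sq_nonneg ‖yosidaRes T s z‖]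
    nlinarith [mul_le_mul_of_nonneg_left h5 hs.le, mul_le_mul_of_nonneg_right h3 (norm_nonneg z)]
  refine le_of_sq_le_sq ?_ (by positivity)
  rw [mul_pow, mul_pow, Real.sq_sqrt hs.le]
  nlinarith

/-- The sense in which `yosida T s` approximates `T⁻¹`: applied to `T y` it returns `y` up to the
error `s (s - T²)⁻¹ y`. -/
theorem yosida_apply {T : H →L[ℝ] H} (hT : ContinuousLinearMap.adjoint T = -T) {s : ℝ}
    (hs : 0 < s) (y : H) : yosida T s (T y) = y - s • yosidaRes T s y := by
  have hc : yosidaRes T s (T y) = T (yosidaRes T s y) :=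
    (congrArg (fun f : H →L[ℝ] H => f y) (yosidaRes_commute hT hs).eq).symm
  have := yosidaRes_spec hT hs y
  change -(T (yosidaRes T s (T y))) = _
  rw [hc]
  generalize yosidaRes T s y = w at *
  rw [← this]
  abel

/-- The bound does not depend on `s`; it gives the Lipschitz constant in time and the dominating
function for the limit group. -/
theorem norm_yosida_apply_le {T : H →L[ℝ] H} (hT : ContinuousLinearMap.adjoint T = -T) {s : ℝ}
    (hs : 0 < s) (y : H) : ‖yosida T s (T y)‖ ≤ 2 * ‖y‖ := by
  rw [yosida_apply hT hs]
  refine (norm_sub_le _ _).trans ?_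
  rw [norm_smul, Real.norm_of_nonneg hs.le]
  linarith [norm_smul_yosidaRes_le hT hs y]

theorem adjoint_yosida {T : H →L[ℝ] H} (hT : ContinuousLinearMap.adjoint T = -T) {s : ℝ}
    (hs : 0 < s) : star (yosida T s) = -yosida T s := by
  have hT' : star T = -T := hT
  have h1 : star (yosidaRes T s) = yosidaRes T s := by
    rw [yosidaRes, ← Ring.inverse_star]
    simp [hT']
  rw [yosida, star_neg, star_mul, h1, hT', ← (yosidaRes_commute hT hs).neg_left.eq]
  simp

theorem yosida_commute {T : H →L[ℝ] H} (hT : ContinuousLinearMap.adjoint T = -T) {s : ℝ}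
    (hs : 0 < s) : Commute T (yosida T s) :=
  ((Commute.refl T).mul_right (yosidaRes_commute hT hs)).neg_right

theorem commute_yosida_yosida {T : H →L[ℝ] H} (hT : ContinuousLinearMap.adjoint T = -T) {s : ℝ}
    (hs : 0 < s) {s' : ℝ} (hs' : 0 < s') : Commute (yosida T s) (yosida T s') := by
  have h1 : Commute (yosida T s) (s' • (1 : H →L[ℝ] H) - T * T) := by
    have h := (yosida_commute hT hs).symm
    exact ((Commute.one_right _).smul_right s').sub_right (h.mul_right h)
  exact ((yosida_commute hT hs).symm.mul_right
    (commute_ringInverse (isUnit_yosida hT hs') h1)).neg_right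

end InverseOperator

/-! ### The orthogonal group generated by `-T⁻¹`, as a strong limit of exponentials. -/

section Evolution
variable {H : Type*} [NormedAddCommGroup H] [InnerProductSpace ℝ H] [CompleteSpace H]

/-! ### Exponentials of bounded skew-adjoint operators -/

theorem hasDerivAt_exp_smul_apply (B : H →L[ℝ] H) (x : H) (t : ℝ) :
    HasDerivAt (fun t : ℝ => NormedSpace.exp (t • B) x) (NormedSpace.exp (t • B) (B x)) t :=
  (ContinuousLinearMap.apply ℝ H x).hasFDerivAt.comp_hasDerivAt t
    (hasDerivAt_exp_smul_const (𝕂 := ℝ) B t)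

theorem exp_add_smul_apply (B : H →L[ℝ] H) (s t : ℝ) (x : H) :
    NormedSpace.exp ((s + t) • B) x = NormedSpace.exp (s • B) (NormedSpace.exp (t • B) x) := by
  let _ : NormedAlgebra ℚ (H →L[ℝ] H) := NormedAlgebra.restrictScalars ℚ ℝ _
  rw [add_smul, NormedSpace.exp_add_of_commute
    (((Commute.refl B).smul_left s).smul_right t)]
  rfl

theorem norm_exp_smul_apply {B : H →L[ℝ] H} (hB : star B = -B) (t : ℝ) (x : H) :
    ‖NormedSpace.exp (t • B) x‖ = ‖x‖ := by
  have h : star (NormedSpace.exp (t • B)) = NormedSpace.exp ((-t) • B) := by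
    rw [NormedSpace.star_exp]
    simp [hB]
  have h2 : ‖NormedSpace.exp (t • B) x‖ ^ 2 = ‖x‖ ^ 2 := by
    rw [← real_inner_self_eq_norm_sq, ← ContinuousLinearMap.adjoint_inner_right,
      ← ContinuousLinearMap.star_eq_adjoint, h, ← exp_add_smul_apply]
    simp
  exact (sq_eq_sq₀ (norm_nonneg _) (norm_nonneg _)).1 h2

/-- The velocity of the orbit of `x` is `exp(sB) (B x)`, of constant norm `‖B x‖`; this is the mean
value inequality. -/
theorem norm_exp_smul_apply_sub_le {B : H →L[ℝ] H} (hB : star B = -B) (t t' : ℝ) (x : H) :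
    ‖NormedSpace.exp (t • B) x - NormedSpace.exp (t' • B) x‖ ≤ ‖B x‖ * |t - t'| :=
  convex_univ.norm_image_sub_le_of_norm_hasDerivWithin_le (C := ‖B x‖)
    (fun s _ => (hasDerivAt_exp_smul_apply B x s).hasDerivWithinAt)
    (fun s _ => (norm_exp_smul_apply hB s (B x)).le) (mem_univ t') (mem_univ t)

/-- Commutation factors `exp(tB) = exp(tB') exp(t(B - B'))`. The first factor is an isometry, so
only the displacement of `x` under the second one remains. Only the difference at `x` enters, so
strong convergence of the generators suffices. -/
theorem norm_exp_smul_sub_exp_smul_le {B B' : H →L[ℝ] H} (hB : star B = -B) (hB' : star B' = -B')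
    (hc : Commute B B') (t : ℝ) (x : H) :
    ‖NormedSpace.exp (t • B) x - NormedSpace.exp (t • B') x‖ ≤ ‖B x - B' x‖ * |t| := by
  have h1 : NormedSpace.exp (t • B) =
      NormedSpace.exp (t • B') * NormedSpace.exp (t • (B - B')) := by
    let _ : NormedAlgebra ℚ (H →L[ℝ] H) := NormedAlgebra.restrictScalars ℚ ℝ _
    rw [← NormedSpace.exp_add_of_commute]
    · rw [← smul_add]; simp
    · exact (((hc.symm).sub_right (Commute.refl B')).smul_left t).smul_right t
  have h2 : NormedSpace.exp (t • B) x - NormedSpace.exp (t • B') x =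
      NormedSpace.exp (t • B') (NormedSpace.exp (t • (B - B')) x - x) := by
    rw [h1, map_sub]
    rfl
  rw [h2, norm_exp_smul_apply hB']
  have h3 := norm_exp_smul_apply_sub_le (B := B - B') (by rw [star_sub, hB, hB']; abel) t 0 x
  simpa using h3

/-! ### Strong limits of contractions -/

theorem tendsto_of_dense_of_contraction {f : ℕ → H →L[ℝ] H} {g : H →L[ℝ] H} {D : Set H}
    (hD : Dense D) (hf : ∀ n x, ‖f n x‖ ≤ ‖x‖) (hg : ∀ x, ‖g x‖ ≤ ‖x‖)
    (h : ∀ x ∈ D, Filter.Tendsto (fun n => f n x) Filter.atTop (𝓝 (g x))) (x : H) :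
    Filter.Tendsto (fun n => f n x) Filter.atTop (𝓝 (g x)) := by
  rw [Metric.tendsto_atTop]
  intro ε hε
  obtain ⟨y, hy, hxy⟩ := Metric.dense_iff.1 hD x (ε / 3) (by positivity)
  rw [Metric.mem_ball, dist_eq_norm] at hy
  obtain ⟨n, hn⟩ := Metric.tendsto_atTop.1 (h y hxy) (ε / 3) (by positivity)
  refine ⟨n, fun k hk => ?_⟩
  have h1 := hn k hk
  rw [dist_eq_norm] at h1 ⊢
  have h2 := hf k (y - x)
  have h3 := hg (y - x)
  have : f k x - g x = (f k y - g y) - f k (y - x) + g (y - x) := by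
    simp only [map_sub]; abel
  rw [this]
  calc _ ≤ ‖f k y - g y‖ + ‖f k (y - x)‖ + ‖g (y - x)‖ :=
        (norm_add_le _ _).trans (by gcongr; exact norm_sub_le _ _)
    _ < ε := by linarith

theorem cauchySeq_of_dense_of_contraction {f : ℕ → H →L[ℝ] H} {D : Set H}
    (hD : Dense D) (hf : ∀ n x, ‖f n x‖ ≤ ‖x‖)
    (h : ∀ x ∈ D, CauchySeq (fun n => f n x)) (x : H) : CauchySeq (fun n => f n x) := by
  rw [Metric.cauchySeq_iff]
  intro ε hε
  obtain ⟨y, hy, hxy⟩ := Metric.dense_iff.1 hD x (ε / 3) (by positivity)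
  rw [Metric.mem_ball, dist_eq_norm] at hy
  obtain ⟨n, hn⟩ := Metric.cauchySeq_iff.1 (h y hxy) (ε / 3) (by positivity)
  refine ⟨n, fun k hk l hl => ?_⟩
  have h1 := hn k hk l hl
  rw [dist_eq_norm] at h1 ⊢
  have h2 := hf k (y - x)
  have h3 := hf l (y - x)
  have : f k x - f l x = (f k y - f l y) - f k (y - x) + f l (y - x) := by
    simp only [map_sub]; abel
  rw [this]
  calc _ ≤ ‖f k y - f l y‖ + ‖f k (y - x)‖ + ‖f l (y - x)‖ :=
        (norm_add_le _ _).trans (by gcongr; exact norm_sub_le _ _)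
    _ < ε := by linarith

/-! ### The group generated by the inverse of a bounded skew-adjoint operator -/

/-- The groups `exp (-t T (T² - 1/(n+1))⁻¹)`, which approximate `exp (-t T⁻¹)`. -/
def approxEvolution (T : H →L[ℝ] H) (n : ℕ) (t : ℝ) : H →L[ℝ] H :=
  NormedSpace.exp (t • -yosida T (1 / ((n : ℝ) + 1)))

theorem star_neg_yosida {T : H →L[ℝ] H} (hT : ContinuousLinearMap.adjoint T = -T)
    (n : ℕ) : star (-yosida T (1 / ((n : ℝ) + 1))) =
    - -yosida T (1 / ((n : ℝ) + 1)) := by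
  rw [star_neg, adjoint_yosida hT Nat.one_div_pos_of_nat]

theorem norm_approxEvolution {T : H →L[ℝ] H} (hT : ContinuousLinearMap.adjoint T = -T)
    (n : ℕ) (t : ℝ) (x : H) : ‖approxEvolution T n t x‖ = ‖x‖ :=
  norm_exp_smul_apply (star_neg_yosida hT n) t x

theorem approxEvolution_commute {T : H →L[ℝ] H} (hT : ContinuousLinearMap.adjoint T = -T)
    (n : ℕ) (t : ℝ) (x : H) :
    approxEvolution T n t (T x) = T (approxEvolution T n t x) := by
  have h : Commute T (t • -yosida T (1 / ((n : ℝ) + 1))) :=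
    ((yosida_commute hT Nat.one_div_pos_of_nat).neg_right).smul_right t
  exact (congrArg (fun f : H →L[ℝ] H => f x) h.exp_right.eq).symm

/-- The operators `s (s - T²)⁻¹` are contractions and tend to zero like `√s` on the dense range of
`T`. -/
theorem tendsto_smul_yosidaRes {T : H →L[ℝ] H} (hT : ContinuousLinearMap.adjoint T = -T)
    (hd : DenseRange T) (y : H) :
    Filter.Tendsto (fun n : ℕ => (1 / ((n : ℝ) + 1)) • yosidaRes T (1 / ((n : ℝ) + 1)) y)
      Filter.atTop (𝓝 0) := by
  refine tendsto_of_dense_of_contraction (g := 0)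
    (f := fun n : ℕ => (1 / ((n : ℝ) + 1)) • yosidaRes T (1 / ((n : ℝ) + 1))) hd
    (fun n x => ?_) (fun x => by simp) ?_ y
  · have hs : 0 < 1 / ((n : ℝ) + 1) := Nat.one_div_pos_of_nat
    have := norm_smul_yosidaRes_le hT hs x
    simpa only [smul_apply, norm_smul, Real.norm_of_nonneg hs.le] using this
  · rintro _ ⟨z, rfl⟩
    have h0 : Filter.Tendsto (fun n : ℕ => Real.sqrt (1 / ((n : ℝ) + 1)) * ‖z‖) Filter.atTop
        (𝓝 0) := by
      have := (Real.continuous_sqrt.tendsto 0).comp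
        (tendsto_one_div_add_atTop_nhds_zero_nat (𝕜 := ℝ))
      simpa using this.mul_const ‖z‖
    refine squeeze_zero_norm (fun n => ?_) h0
    have hs : 0 < 1 / ((n : ℝ) + 1) := Nat.one_div_pos_of_nat
    have := norm_smul_yosidaRes_apply_le hT hs z
    simpa only [smul_apply, norm_smul, Real.norm_of_nonneg hs.le] using this

theorem tendsto_yosida_apply {T : H →L[ℝ] H} (hT : ContinuousLinearMap.adjoint T = -T)
    (hd : DenseRange T) (y : H) :
    Filter.Tendsto (fun n : ℕ => yosida T (1 / ((n : ℝ) + 1)) (T y)) Filter.atTop (𝓝 y) := by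
  have := (tendsto_smul_yosidaRes hT hd y).const_sub y
  rw [sub_zero] at this
  exact this.congr fun n => (yosida_apply hT Nat.one_div_pos_of_nat y).symm

theorem cauchySeq_approxEvolution {T : H →L[ℝ] H} (hT : ContinuousLinearMap.adjoint T = -T)
    (hd : DenseRange T) (t : ℝ) (x : H) :
    CauchySeq fun n => approxEvolution T n t x := by
  refine cauchySeq_of_dense_of_contraction (f := fun n => approxEvolution T n t) hd
    (fun n x => (norm_approxEvolution hT n t x).le) ?_ x
  rintro _ ⟨y, rfl⟩
  have hc := (tendsto_yosida_apply hT hd y).cauchySeq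
  rw [Metric.cauchySeq_iff] at hc ⊢
  intro ε hε
  -- The added `1` covers `t = 0`.
  obtain ⟨n, hn⟩ := hc (ε / (|t| + 1)) (by positivity)
  refine ⟨n, fun k hk l hl => ?_⟩
  have h1 := hn k hk l hl
  have h2 := norm_exp_smul_sub_exp_smul_le (star_neg_yosida hT k) (star_neg_yosida hT l)
    (commute_yosida_yosida hT Nat.one_div_pos_of_nat Nat.one_div_pos_of_nat).neg_left.neg_right
    t (T y)
  rw [dist_eq_norm] at h1 ⊢
  refine h2.trans_lt ?_
  simp only [neg_apply, neg_sub_neg]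
  rw [lt_div_iff₀ (by positivity)] at h1
  rw [norm_sub_rev]
  nlinarith [norm_nonneg (yosida T (1 / ((k : ℝ) + 1)) (T y) - yosida T (1 / ((l : ℝ) + 1)) (T y))]

theorem exists_evolution {T : H →L[ℝ] H} (hT : ContinuousLinearMap.adjoint T = -T)
    (hd : DenseRange T) : ∃ U : ℝ → H →L[ℝ] H, ∀ t x,
    Filter.Tendsto (fun n => approxEvolution T n t x) Filter.atTop (𝓝 (U t x)) := by
  choose u hu using fun t x => cauchySeq_tendsto_of_complete (cauchySeq_approxEvolution hT hd t x)
  let L : ℝ → H →ₗ[ℝ] H := fun t => linearMapOfTendsto (u t)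
    (fun n => (approxEvolution T n t).toLinearMap) (tendsto_pi_nhds.2 (hu t))
  refine ⟨fun t => (L t).mkContinuous 1 fun x => ?_, hu⟩
  rw [one_mul]
  exact le_of_tendsto (hu t x).norm
    (Filter.Eventually.of_forall fun n => (norm_approxEvolution hT n t x).le)

theorem norm_evolution {T : H →L[ℝ] H} (hT : ContinuousLinearMap.adjoint T = -T)
    {U : ℝ → H →L[ℝ] H}
    (hU : ∀ t x, Filter.Tendsto (fun n => approxEvolution T n t x) Filter.atTop (𝓝 (U t x)))
    (t : ℝ) (x : H) : ‖U t x‖ = ‖x‖ := by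
  refine tendsto_nhds_unique (hU t x).norm ?_
  simp only [norm_approxEvolution hT, tendsto_const_nhds_iff]

theorem evolution_commute {T : H →L[ℝ] H} (hT : ContinuousLinearMap.adjoint T = -T)
    {U : ℝ → H →L[ℝ] H}
    (hU : ∀ t x, Filter.Tendsto (fun n => approxEvolution T n t x) Filter.atTop (𝓝 (U t x)))
    (t : ℝ) (x : H) : U t (T x) = T (U t x) := by
  refine tendsto_nhds_unique (hU t (T x)) ?_
  simp only [approxEvolution_commute hT]
  exact (T.continuous.tendsto _).comp (hU t x)

/-- Because the approximating groups are isometric, the vector to which they are applied may vary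
with `n`. This passes products of evolutions and the integrand below to the limit. -/
theorem tendsto_approxEvolution_apply {T : H →L[ℝ] H} (hT : ContinuousLinearMap.adjoint T = -T)
    {U : ℝ → H →L[ℝ] H}
    (hU : ∀ t x, Filter.Tendsto (fun n => approxEvolution T n t x) Filter.atTop (𝓝 (U t x)))
    {y : ℕ → H} {z : H} (hy : Filter.Tendsto y Filter.atTop (𝓝 z))
    (t : ℝ) : Filter.Tendsto (fun n => approxEvolution T n t (y n)) Filter.atTop (𝓝 (U t z)) := by
  have h1 : Filter.Tendsto (fun n => approxEvolution T n t (y n - z)) Filter.atTop (𝓝 0) := by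
    rw [tendsto_zero_iff_norm_tendsto_zero]
    simp only [norm_approxEvolution hT]
    rw [← tendsto_zero_iff_norm_tendsto_zero, ← sub_self z]
    exact hy.sub_const z
  have := h1.add (hU t z)
  simpa using this

theorem evolution_add {T : H →L[ℝ] H} (hT : ContinuousLinearMap.adjoint T = -T)
    {U : ℝ → H →L[ℝ] H}
    (hU : ∀ t x, Filter.Tendsto (fun n => approxEvolution T n t x) Filter.atTop (𝓝 (U t x)))
    (s t : ℝ) (x : H) : U (s + t) x = U s (U t x) := by
  refine tendsto_nhds_unique (hU (s + t) x) ?_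
  refine (tendsto_approxEvolution_apply hT hU (hU t x) s).congr fun n => ?_
  exact (exp_add_smul_apply _ _ _ _).symm

theorem evolution_zero {T : H →L[ℝ] H} {U : ℝ → H →L[ℝ] H}
    (hU : ∀ t x, Filter.Tendsto (fun n => approxEvolution T n t x) Filter.atTop (𝓝 (U t x)))
    (x : H) : U 0 x = x := by
  refine tendsto_nhds_unique (hU 0 x) ?_
  simp [approxEvolution]

theorem continuous_evolution {T : H →L[ℝ] H} (hT : ContinuousLinearMap.adjoint T = -T)
    {U : ℝ → H →L[ℝ] H}
    (hU : ∀ t x, Filter.Tendsto (fun n => approxEvolution T n t x) Filter.atTop (𝓝 (U t x)))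
    (hd : DenseRange T) (x : H) : Continuous fun t => U t x := by
  -- Orbits of vectors in the range of `T` are Lipschitz, uniformly along the approximation;
  -- continuity of the other orbits follows by density and isometry.
  have hL : ∀ y t t', ‖U t (T y) - U t' (T y)‖ ≤ 2 * ‖y‖ * |t - t'| := by
    intro y t t'
    refine le_of_tendsto ((hU t (T y)).sub (hU t' (T y))).norm
      (Filter.Eventually.of_forall fun n => ?_)
    refine (norm_exp_smul_apply_sub_le (star_neg_yosida hT n) t t' (T y)).trans ?_
    gcongr
    rw [neg_apply, norm_neg]
    exact norm_yosida_apply_le hT Nat.one_div_pos_of_nat y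
  rw [Metric.continuous_iff]
  intro t ε hε
  obtain ⟨_, hy, ⟨z, rfl⟩⟩ := Metric.dense_iff.1 hd x (ε / 3) (by positivity)
  rw [Metric.mem_ball, dist_eq_norm] at hy
  refine ⟨ε / 3 / (2 * ‖z‖ + 1), by positivity, fun t' ht' => ?_⟩
  rw [Real.dist_eq, lt_div_iff₀ (by positivity)] at ht'
  have h1 := hL z t' t
  have h2 := norm_evolution hT hU t' (T z - x)
  have h3 := norm_evolution hT hU t (T z - x)
  rw [dist_eq_norm]
  have : U t' x - U t x = (U t' (T z) - U t (T z)) - U t' (T z - x) + U t (T z - x) := by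
    simp only [map_sub]; abel
  rw [this]
  calc _ ≤ ‖U t' (T z) - U t (T z)‖ + ‖U t' (T z - x)‖ + ‖U t (T z - x)‖ :=
        (norm_add_le _ _).trans (by gcongr; exact norm_sub_le _ _)
    _ < ε := by nlinarith [abs_nonneg (t' - t)]

/-- Strong convergence alone does not carry derivatives to the limit, so the differential equation
is passed in integrated form, by dominated convergence, and differentiated again afterwards. -/
theorem evolution_sub_eq_integral {T : H →L[ℝ] H} (hT : ContinuousLinearMap.adjoint T = -T)
    {U : ℝ → H →L[ℝ] H}
    (hU : ∀ t x, Filter.Tendsto (fun n => approxEvolution T n t x) Filter.atTop (𝓝 (U t x)))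
    (hd : DenseRange T) (y : H) (t : ℝ) :
    U t (T y) - T y = ∫ τ in (0 : ℝ)..t, U τ (-y) := by
  have h1 : ∀ n : ℕ, approxEvolution T n t (T y) - T y =
      ∫ τ in (0 : ℝ)..t, approxEvolution T n τ (-yosida T (1 / ((n : ℝ) + 1)) (T y)) := by
    intro n
    have hder := hasDerivAt_exp_smul_apply (-yosida T (1 / ((n : ℝ) + 1))) (T y)
    have hcont : Continuous fun τ : ℝ => NormedSpace.exp (τ • -yosida T (1 / ((n : ℝ) + 1)))
        ((-yosida T (1 / ((n : ℝ) + 1))) (T y)) :=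
      continuous_iff_continuousAt.2 fun τ => (hasDerivAt_exp_smul_apply _ _ τ).continuousAt
    have := intervalIntegral.integral_eq_sub_of_hasDerivAt (a := 0) (b := t)
      (fun τ _ => hder τ) (hcont.intervalIntegrable _ _)
    simp only [zero_smul, NormedSpace.exp_zero] at this
    exact this.symm
  refine tendsto_nhds_unique ((hU t (T y)).sub_const (T y)) ?_
  simp only [h1]
  refine intervalIntegral.tendsto_integral_filter_of_dominated_convergence (fun _ => 2 * ‖y‖)
    (Filter.Eventually.of_forall fun n => ?_) (Filter.Eventually.of_forall fun n => ?_) ?_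
    (Filter.Eventually.of_forall fun τ _ => ?_)
  · refine Continuous.aestronglyMeasurable ?_
    exact continuous_iff_continuousAt.2 fun τ => (hasDerivAt_exp_smul_apply _ _ τ).continuousAt
  · refine Filter.Eventually.of_forall fun τ _ => ?_
    rw [norm_approxEvolution hT, norm_neg]
    exact norm_yosida_apply_le hT Nat.one_div_pos_of_nat y
  · exact intervalIntegrable_const
  · exact tendsto_approxEvolution_apply hT hU (tendsto_yosida_apply hT hd y).neg τ

theorem hasDerivAt_evolution {T : H →L[ℝ] H} (hT : ContinuousLinearMap.adjoint T = -T)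
    {U : ℝ → H →L[ℝ] H}
    (hU : ∀ t x, Filter.Tendsto (fun n => approxEvolution T n t x) Filter.atTop (𝓝 (U t x)))
    (hd : DenseRange T) (y : H) :
    HasDerivAt (fun t => U t (T y)) (-y) 0 := by
  have hc := continuous_evolution hT hU hd (-y)
  have h := intervalIntegral.integral_hasDerivAt_right (a := 0) (b := 0)
    (hc.intervalIntegrable _ _) hc.aestronglyMeasurable.stronglyMeasurableAtFilter hc.continuousAt
  rw [evolution_zero hU] at h
  refine (h.add_const (T y)).congr_of_eventuallyEq (Filter.Eventually.of_forall fun t => ?_)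
  simp only [← evolution_sub_eq_integral hT hU hd y t, sub_add_cancel]

theorem inner_evolution {T : H →L[ℝ] H} (hT : ContinuousLinearMap.adjoint T = -T)
    {U : ℝ → H →L[ℝ] H}
    (hU : ∀ t x, Filter.Tendsto (fun n => approxEvolution T n t x) Filter.atTop (𝓝 (U t x)))
    (t : ℝ) (x y : H) : inner ℝ (U t x) (U t y) = inner ℝ x y :=
  (LinearMap.norm_map_iff_inner_map_map (𝕜 := ℝ) (U t)).1 (norm_evolution hT hU t) x y

theorem isEvolution_inverseOp {T : H →L[ℝ] H} (hT : ContinuousLinearMap.adjoint T = -T)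
    {U : ℝ → H →L[ℝ] H}
    (hU : ∀ t x, Filter.Tendsto (fun n => approxEvolution T n t x) Filter.atTop (𝓝 (U t x)))
    (hd : DenseRange T) : IsEvolution (inverseOp T) U where
  zero := evolution_zero hU
  add := evolution_add hT hU
  norm_map := norm_evolution hT hU
  continuous := continuous_evolution hT hU hd
  generator x y := by
    rw [mem_graph_inverseOp (injective_of_skew hT hd)]
    constructor
    · intro h
      -- The generator is no larger than `-T⁻¹`: the derivative at zero of `⟨U t x, T v⟩ = ⟨x, U
      -- (-t) (T v)⟩`, computed on both sides, gives `⟨-y, T v⟩ = ⟨x, v⟩`, hence `⟨T y, v⟩ = ⟨x,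
      -- v⟩`.
      refine ext_inner_right ℝ fun v => ?_
      have h1 : HasDerivAt (fun t => inner ℝ (U t x) (T v)) (inner ℝ (-y) (T v)) 0 := by
        simpa using h.inner ℝ (hasDerivAt_const (0 : ℝ) (T v))
      have h2 : HasDerivAt (fun t => U (-t) (T v)) v 0 := by
        have := (hasDerivAt_evolution hT hU hd v)
        rw [← neg_zero] at this
        simpa [Function.comp_def] using this.scomp (0 : ℝ) (hasDerivAt_neg 0)
      have h3 : HasDerivAt (fun t => inner ℝ x (U (-t) (T v))) (inner ℝ x v) 0 := by
        simpa using (hasDerivAt_const (0 : ℝ) x).inner ℝ h2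
      have h4 : (fun t => inner ℝ (U t x) (T v)) = fun t => inner ℝ x (U (-t) (T v)) := by
        ext t
        rw [← inner_evolution hT hU t x, ← evolution_add hT hU]
        simp [evolution_zero hU]
      rw [h4] at h1
      have := h1.unique h3
      rw [inner_neg_left, ← inner_skew hT] at this
      exact this
    · rintro rfl
      exact hasDerivAt_evolution hT hU hd y

end Evolution

/-! ### Local coordinate expressions and flat integration by parts. -/

section Divergence
variable {d : ℕ} {X : Type*} [TopologicalSpace X] [ChartedSpace (EuclideanSpace ℝ (Fin d)) X]
  [IsManifold (𝓡 d) ∞ X]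

/-! ### Metric, vector fields and functions in charts -/

/-- The coordinate frame identifies `ℝ^d` with the tangent space, so a nonzero coordinate vector
gives a nonzero tangent vector, on which the metric is positive. -/
theorem gramAt_posDef (γ : RMetric d X) {q p : X}
    (hp : p ∈ (chartAt (EuclideanSpace ℝ (Fin d)) q).source) : (gramAt γ q p).PosDef := by
  have hp' : p ∈ (trivializationAt (EuclideanSpace ℝ (Fin d)) (TangentSpace (𝓡 d)) q).baseSet := by
    simpa using hp
  have hfr : ∀ x : Fin d → ℝ, frame q (WithLp.toLp 2 x) p =
      ∑ i, x i • frame q (EuclideanSpace.single i 1) p := by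
    intro x
    have hv : WithLp.toLp 2 x = ∑ i, x i • EuclideanSpace.single i (1 : ℝ) := by
      ext j; simp [Pi.single_apply]
    conv_lhs => rw [hv]
    simp [frame]
  refine Matrix.PosDef.of_dotProduct_mulVec_pos ?_ fun x hx => ?_
  · ext i j
    simp only [gramAt, Matrix.conjTranspose_apply, Matrix.of_apply, star_trivial]
    exact γ.symm _ _ _
  · have h0 : frame q (WithLp.toLp 2 x) p ≠ 0 := by
      intro h
      apply hx
      have := congrArg ((trivializationAt (EuclideanSpace ℝ (Fin d))
        (TangentSpace (𝓡 d)) q).continuousLinearMapAt ℝ p) h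
      rw [frame, Bundle.Trivialization.continuousLinearMapAt_symmL _ hp', map_zero] at this
      simpa using this
    have := γ.pos p _ h0
    rw [hfr] at this
    refine this.trans_eq ?_
    simp only [map_sum, map_smul, sum_apply, smul_apply, smul_eq_mul, dotProduct, Matrix.mulVec,
      gramAt, Matrix.of_apply, star_trivial, Finset.mul_sum, frame]
    rw [Finset.sum_comm]
    refine Finset.sum_congr rfl fun k _ => Finset.sum_congr rfl fun l _ => ?_
    ring

theorem volDensity_pos (γ : RMetric d X) (q : X) {y : EuclideanSpace ℝ (Fin d)}
    (hy : y ∈ (extChartAt (𝓡 d) q).target) : 0 < volDensity γ q y := by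
  rw [volDensity, gram_eq γ q hy]
  exact Real.sqrt_pos.2 (gramAt_posDef γ
    (by simpa using (extChartAt (𝓡 d) q).map_target hy)).det_pos

/-- A smooth function on a chart domain, read in the chart. -/
theorem contDiffOn_comp_chart_symm {F : Type*} [NormedAddCommGroup F] [NormedSpace ℝ F] {q : X}
    {f : X → F} (hf : ContMDiffOn (𝓡 d) 𝓘(ℝ, F) ∞ f
      (chartAt (EuclideanSpace ℝ (Fin d)) q).source) :
    ContDiffOn ℝ ∞ (fun y => f ((extChartAt (𝓡 d) q).symm y)) (extChartAt (𝓡 d) q).target := by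
  rw [← contMDiffOn_iff_contDiffOn]
  refine hf.comp (contMDiffOn_extChartAt_symm q) fun y hy => ?_
  simpa using (extChartAt (𝓡 d) q).map_target hy

theorem contDiffOn_volDensity (γ : RMetric d X) (q : X) :
    ContDiffOn ℝ ∞ (volDensity γ q) (extChartAt (𝓡 d) q).target := by
  have h : ContDiffOn ℝ ∞ (fun y => (gramAt γ q ((extChartAt (𝓡 d) q).symm y)).det)
      (extChartAt (𝓡 d) q).target := by
    simp only [Matrix.det_apply]
    refine ContDiffOn.sum fun σ _ => ContDiffOn.const_smul _ (contDiffOn_prod fun i _ => ?_)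
    exact contDiffOn_comp_chart_symm (contMDiffOn_gramAt γ q _ _)
  have h2 : ContDiffOn ℝ ∞ (fun y => Real.sqrt (gramAt γ q ((extChartAt (𝓡 d) q).symm y)).det)
      (extChartAt (𝓡 d) q).target := by
    refine h.sqrt fun y hy => ?_
    exact (gramAt_posDef γ (by simpa using (extChartAt (𝓡 d) q).map_target hy)).det_pos.ne'
  refine h2.congr fun y hy => ?_
  rw [volDensity, gram_eq γ q hy]

theorem contDiffOn_coordComp {V : ∀ p : X, TangentSpace (𝓡 d) p}
    (hV : ContMDiff (𝓡 d) (𝓡 d).tangent ∞ (fun p => (⟨p, V p⟩ : TangentBundle (𝓡 d) X)))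
    (q : X) (i : Fin d) :
    ContDiffOn ℝ ∞ (fun y => coordComp V q y i) (extChartAt (𝓡 d) q).target := by
  set e := trivializationAt (EuclideanSpace ℝ (Fin d)) (TangentSpace (𝓡 d) (M := X)) q
  have h1 : ContMDiffOn (𝓡 d) 𝓘(ℝ, EuclideanSpace ℝ (Fin d)) ∞ (fun p => (e ⟨p, V p⟩).2)
      e.baseSet := (e.contMDiffOn_section_baseSet_iff).1 hV.contMDiffOn
  have h2 : ContDiffOn ℝ ∞ (fun y => (EuclideanSpace.proj i : EuclideanSpace ℝ (Fin d) →L[ℝ] ℝ)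
      (e ⟨(extChartAt (𝓡 d) q).symm y, V ((extChartAt (𝓡 d) q).symm y)⟩).2)
      (extChartAt (𝓡 d) q).target :=
    (ContinuousLinearMap.contDiff _).comp_contDiffOn
      (contDiffOn_comp_chart_symm (h1.mono (by simp [e])))
  refine h2.congr fun y hy => ?_
  have hp : (extChartAt (𝓡 d) q).symm y ∈ (chartAt (EuclideanSpace ℝ (Fin d)) q).source := by
    simpa using (extChartAt (𝓡 d) q).map_target hy
  have h3 := TangentBundle.continuousLinearMapAt_trivializationAt (𝕜 := ℝ) (I := 𝓡 d) hp
  have h4 := congrArg (fun L => L (V ((extChartAt (𝓡 d) q).symm y))) h3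
  rw [Bundle.Trivialization.continuousLinearMapAt_apply,
    Bundle.Trivialization.linearMapAt_apply, if_pos (by simpa using hp)] at h4
  simp only [coordComp, mvfderiv]
  exact congrArg (fun v : EuclideanSpace ℝ (Fin d) => v i) h4.symm

theorem mvfderiv_eq_sum {f : X → ℝ} (hf : ContMDiff (𝓡 d) 𝓘(ℝ) ∞ f)
    (V : ∀ p : X, TangentSpace (𝓡 d) p) (q : X) {y : EuclideanSpace ℝ (Fin d)}
    (hy : y ∈ (extChartAt (𝓡 d) q).target) :
    mvfderiv (𝓡 d) f ((extChartAt (𝓡 d) q).symm y) (V ((extChartAt (𝓡 d) q).symm y)) =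
      ∑ i, coordComp V q y i * fderiv ℝ (fun z => f ((extChartAt (𝓡 d) q).symm z)) y
        (EuclideanSpace.single i 1) := by
  set p := (extChartAt (𝓡 d) q).symm y with hpdef
  have hp : p ∈ (extChartAt (𝓡 d) q).source := (extChartAt (𝓡 d) q).map_target hy
  have hp' : p ∈ (chartAt (EuclideanSpace ℝ (Fin d)) q).source := by simpa using hp
  have hyp : extChartAt (𝓡 d) q p = y := (extChartAt (𝓡 d) q).right_inv hy
  set g : EuclideanSpace ℝ (Fin d) → ℝ := fun z => f ((extChartAt (𝓡 d) q).symm z)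
  have hg : ContDiffAt ℝ ∞ g y :=
    (contDiffOn_comp_chart_symm hf.contMDiffOn).contDiffAt
      ((isOpen_extChartAt_target q).mem_nhds hy)
  have hgd : DifferentiableAt ℝ g y := hg.differentiableAt (by simp)
  have heq : f =ᶠ[𝓝 p] g ∘ extChartAt (𝓡 d) q := by
    filter_upwards [(isOpen_extChartAt_source (I := 𝓡 d) q).mem_nhds hp] with r hr
    simp only [g, Function.comp_apply, (extChartAt (𝓡 d) q).left_inv hr]
  have h1 : mvfderiv (𝓡 d) f p (V p) =
      fderiv ℝ g y (mvfderiv (𝓡 d) (extChartAt (𝓡 d) q) p (V p)) := by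
    have h2 : mfderiv (𝓡 d) 𝓘(ℝ) f p = mfderiv (𝓡 d) 𝓘(ℝ) (g ∘ extChartAt (𝓡 d) q) p :=
      heq.mfderiv_eq
    have h3 : mfderiv (𝓡 d) 𝓘(ℝ) (g ∘ extChartAt (𝓡 d) q) p =
        (mfderiv 𝓘(ℝ, EuclideanSpace ℝ (Fin d)) 𝓘(ℝ) g (extChartAt (𝓡 d) q p)).comp
          (mfderiv (𝓡 d) 𝓘(ℝ, EuclideanSpace ℝ (Fin d)) (extChartAt (𝓡 d) q) p) :=
      mfderiv_comp p (by rw [hyp]; exact hgd.mdifferentiableAt) (mdifferentiableAt_extChartAt hp')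
    rw [mfderiv_eq_fderiv, hyp] at h3
    have h4 := h2.trans h3
    exact congrArg (fun L => L (V p)) h4
  rw [h1]
  have hv : ∀ v : EuclideanSpace ℝ (Fin d), v = ∑ i, v i • EuclideanSpace.single i (1 : ℝ) := by
    intro v; ext j; simp [Pi.single_apply]
  conv_lhs => rw [hv (mvfderiv (𝓡 d) (extChartAt (𝓡 d) q) p (V p))]
  simp only [map_sum, map_smul, smul_eq_mul]
  rfl

/-! ### Integration by parts in an open subset of a Euclidean space -/

section Euclidean
variable {E : Type*} [NormedAddCommGroup E] [NormedSpace ℝ E] [FiniteDimensional ℝ E]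
  [MeasurableSpace E] [BorelSpace E] {μ : Measure E} [μ.IsAddHaarMeasure]

theorem integrable_mul_of_tsupport_subset {Ω : Set E} (hΩ : IsOpen Ω) {W F : E → ℝ}
    (hW : ContinuousOn W Ω) (hF : Continuous F) (hc : HasCompactSupport F) (hs : tsupport F ⊆ Ω) :
    Integrable (fun x => W x * F x) μ := by
  have h1 : tsupport (fun x => W x * F x) ⊆ tsupport F :=
    closure_mono (Function.support_mul_subset_right W F)
  have h2 : Continuous (fun x => W x * F x) :=
    continuous_of_tsupport fun x hx => ((hW.mul hF.continuousOn).continuousAt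
      (hΩ.mem_nhds (hs (h1 hx))))
  exact h2.integrable_of_hasCompactSupport hc.mul_left

/-- The coefficient `W` is controlled only on `Ω`, as chart expressions are only on the target of
the chart. Its values and derivatives elsewhere are multiplied by zero, so `W` needs no cutoff. -/
theorem integral_mul_fderiv_eq_neg_of_tsupport_subset {Ω : Set E} (hΩ : IsOpen Ω) {W F : E → ℝ}
    (hW : ContDiffOn ℝ ∞ W Ω) (hF : ContDiff ℝ ∞ F) (hc : HasCompactSupport F)
    (hs : tsupport F ⊆ Ω) (v : E) :
    Integrable (fun x => W x * fderiv ℝ F x v) μ ∧ Integrable (fun x => fderiv ℝ W x v * F x) μ ∧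
    ∫ x, W x * fderiv ℝ F x v ∂μ = -∫ x, fderiv ℝ W x v * F x ∂μ := by
  have h1 : Integrable (fun x => W x * fderiv ℝ F x v) μ :=
    integrable_mul_of_tsupport_subset hΩ hW.continuousOn
      ((hF.continuous_fderiv (by simp)).clm_apply continuous_const) (hc.fderiv_apply ℝ v)
      ((tsupport_fderiv_apply_subset ℝ v).trans hs)
  have h2 : Integrable (fun x => fderiv ℝ W x v * F x) μ :=
    integrable_mul_of_tsupport_subset hΩ
      ((hW.continuousOn_fderiv_of_isOpen hΩ (by simp)).clm_apply continuousOn_const)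
      hF.continuous hc hs
  refine ⟨h1, h2, integral_mul_fderiv_eq_neg_fderiv_mul_of_integrable h2 h1
    (integrable_mul_of_tsupport_subset hΩ hW.continuousOn hF.continuous hc hs) (fun x hx => ?_)
    fun x _ => (hF.differentiable (by simp)) x⟩
  exact (hW.contDiffAt (hΩ.mem_nhds (hs hx))).differentiableAt (by simp)

end Euclidean
end Divergence

/-! ### Chart independence of the divergence and integration by parts on the manifold. -/

section DivergenceTheorem
variable {d : ℕ} {X : Type*} [TopologicalSpace X] [ChartedSpace (EuclideanSpace ℝ (Fin d)) X]
  [IsManifold (𝓡 d) ∞ X]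

/-! ### The divergence theorem -/

/-- The divergence of `V` at `p`, computed in the chart at `q`. -/
def chartDiv (γ : RMetric d X) (V : ∀ p : X, TangentSpace (𝓡 d) p) (q p : X) : ℝ :=
  (volDensity γ q (extChartAt (𝓡 d) q p))⁻¹ *
    ∑ i : Fin d, fderiv ℝ (fun y => volDensity γ q y * coordComp V q y i)
      (extChartAt (𝓡 d) q p) (EuclideanSpace.single i 1)

theorem contMDiffOn_chartDiv (γ : RMetric d X) {V : ∀ p : X, TangentSpace (𝓡 d) p}
    (hV : ContMDiff (𝓡 d) (𝓡 d).tangent ∞ (fun p => (⟨p, V p⟩ : TangentBundle (𝓡 d) X))) (q : X) :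
    ContMDiffOn (𝓡 d) 𝓘(ℝ) ∞ (chartDiv γ V q) (chartAt (EuclideanSpace ℝ (Fin d)) q).source := by
  have hρ := contDiffOn_volDensity γ q
  have h : ContDiffOn ℝ ∞ (fun z => (volDensity γ q z)⁻¹ *
      ∑ i : Fin d, fderiv ℝ (fun y => volDensity γ q y * coordComp V q y i) z
        (EuclideanSpace.single i 1)) (extChartAt (𝓡 d) q).target := by
    refine (hρ.inv fun y hy => (volDensity_pos γ q hy).ne').mul (ContDiffOn.sum fun i _ => ?_)
    exact ((hρ.mul (contDiffOn_coordComp hV q i)).fderiv_of_isOpen (isOpen_extChartAt_target q)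
      (by simp)).clm_apply contDiffOn_const
  refine h.contMDiffOn.comp (contMDiffOn_extChartAt (I := 𝓡 d) (x := q)) fun p hp => ?_
  exact (extChartAt (𝓡 d) q).map_source (by simpa using hp)

/-- A function of compact support in a chart domain, read in the chart and extended by zero. -/
def chartExtend (q : X) (f : X → ℝ) : EuclideanSpace ℝ (Fin d) → ℝ :=
  (extChartAt (𝓡 d) q).target.indicator fun y => f ((extChartAt (𝓡 d) q).symm y)

theorem chartExtend_eventuallyEq {q : X} (f : X → ℝ) {y : EuclideanSpace ℝ (Fin d)}
    (hy : y ∈ (extChartAt (𝓡 d) q).target) :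
    chartExtend (d := d) q f =ᶠ[𝓝 y] fun z => f ((extChartAt (𝓡 d) q).symm z) := by
  filter_upwards [(isOpen_extChartAt_target (I := 𝓡 d) q).mem_nhds hy] with z hz
  rw [chartExtend, indicator_of_mem hz]

theorem isCompact_image_tsupport {q : X} {f : X → ℝ} (hc : HasCompactSupport f)
    (hs : tsupport f ⊆ (chartAt (EuclideanSpace ℝ (Fin d)) q).source) :
    IsCompact (extChartAt (𝓡 d) q '' tsupport f) :=
  hc.isCompact.image_of_continuousOn ((continuousOn_extChartAt q).mono (by simpa using hs))

theorem image_tsupport_subset {q : X} {f : X → ℝ}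
    (hs : tsupport f ⊆ (chartAt (EuclideanSpace ℝ (Fin d)) q).source) :
    extChartAt (𝓡 d) q '' tsupport f ⊆ (extChartAt (𝓡 d) q).target := by
  rintro _ ⟨p, hp, rfl⟩
  exact (extChartAt (𝓡 d) q).map_source (by simpa using hs hp)

theorem chartExtend_eq_zero {q : X} {f : X → ℝ} {y : EuclideanSpace ℝ (Fin d)}
    (hy : y ∉ extChartAt (𝓡 d) q '' tsupport f) : chartExtend q f y = 0 := by
  by_cases h : y ∈ (extChartAt (𝓡 d) q).target
  · rw [chartExtend, indicator_of_mem h]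
    refine image_eq_zero_of_notMem_tsupport fun h' => hy ⟨_, h', (extChartAt (𝓡 d) q).right_inv h⟩
  · rw [chartExtend, indicator_of_notMem h]

theorem hasCompactSupport_chartExtend {q : X} {f : X → ℝ} (hc : HasCompactSupport f)
    (hs : tsupport f ⊆ (chartAt (EuclideanSpace ℝ (Fin d)) q).source) :
    HasCompactSupport (chartExtend (d := d) q f) :=
  HasCompactSupport.intro (isCompact_image_tsupport hc hs) fun _ => chartExtend_eq_zero

theorem tsupport_chartExtend_subset {q : X} {f : X → ℝ} (hc : HasCompactSupport f)
    (hs : tsupport f ⊆ (chartAt (EuclideanSpace ℝ (Fin d)) q).source) :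
    tsupport (chartExtend (d := d) q f) ⊆ (extChartAt (𝓡 d) q).target := by
  refine (closure_minimal ?_ (isCompact_image_tsupport hc hs).isClosed).trans
    (image_tsupport_subset hs)
  intro y hy
  by_contra h
  exact hy (chartExtend_eq_zero h)

/-- Compactness makes the image of the support closed in the whole Euclidean space, so its
complement is an open set on which the extension vanishes, and with the chart target it covers the
space. -/
theorem contDiff_chartExtend {q : X} {f : X → ℝ} (hf : ContMDiff (𝓡 d) 𝓘(ℝ) ∞ f)
    (hc : HasCompactSupport f)
    (hs : tsupport f ⊆ (chartAt (EuclideanSpace ℝ (Fin d)) q).source) :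
    ContDiff ℝ ∞ (chartExtend (d := d) q f) := by
  rw [contDiff_iff_contDiffAt]
  intro y
  by_cases h : y ∈ (extChartAt (𝓡 d) q).target
  · refine ContDiffAt.congr_of_eventuallyEq ?_ (chartExtend_eventuallyEq f h)
    exact (contDiffOn_comp_chart_symm hf.contMDiffOn).contDiffAt
      ((isOpen_extChartAt_target q).mem_nhds h)
  · have h' : (extChartAt (𝓡 d) q '' tsupport f)ᶜ ∈ 𝓝 y :=
      (isCompact_image_tsupport hc hs).isClosed.isOpen_compl.mem_nhds
        fun h' => h (image_tsupport_subset hs h')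
    refine (contDiffAt_const (c := (0 : ℝ))).congr_of_eventuallyEq ?_
    filter_upwards [h'] with z hz using chartExtend_eq_zero hz

theorem mvfderiv_eq_zero_of_notMem_tsupport {f : X → ℝ} {p : X} (hp : p ∉ tsupport f) :
    mvfderiv (𝓡 d) f p = 0 := by
  have : f =ᶠ[𝓝 p] fun _ => (0 : ℝ) := notMem_tsupport_iff_eventuallyEq.1 hp
  rw [mvfderiv, this.mfderiv_eq, mfderiv_const]
  rfl

theorem mvfderiv_finsetSum {ι : Type*} (s : Finset ι) {f : ι → X → ℝ} {p : X}
    (hf : ∀ i, MDifferentiableAt (𝓡 d) 𝓘(ℝ) (f i) p) :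
    mvfderiv (𝓡 d) (fun p => ∑ i ∈ s, f i p) p = ∑ i ∈ s, mvfderiv (𝓡 d) (f i) p := by
  have h : MDifferentiableAt (𝓡 d) 𝓘(ℝ) (fun p => ∑ i ∈ s, f i p) p ∧
      mvfderiv (𝓡 d) (fun p => ∑ i ∈ s, f i p) p = ∑ i ∈ s, mvfderiv (𝓡 d) (f i) p := by
    classical
    induction s using Finset.induction_on with
    | empty => simpa using ⟨mdifferentiableAt_const, mvfderiv_const (0 : ℝ)⟩
    | insert i s hi ih =>
      simp only [Finset.sum_insert hi]
      exact ⟨(hf i).add ih.1, by rw [mvfderiv_fun_add (hf i) ih.1, ih.2]⟩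
  exact h.2

theorem contMDiff_mvfderiv_apply {f : X → ℝ} (hf : ContMDiff (𝓡 d) 𝓘(ℝ) ∞ f)
    {V : ∀ p : X, TangentSpace (𝓡 d) p}
    (hV : ContMDiff (𝓡 d) (𝓡 d).tangent ∞ (fun p => (⟨p, V p⟩ : TangentBundle (𝓡 d) X))) :
    ContMDiff (𝓡 d) 𝓘(ℝ) ∞ (fun p => mvfderiv (𝓡 d) f p (V p)) := by
  intro p
  have := ContMDiffAt.clm_bundle_apply (F₁ := EuclideanSpace ℝ (Fin d)) (F₂ := ℝ)
    (E₁ := fun p : X => TangentSpace (𝓡 d) p) (E₂ := Bundle.Trivial X ℝ) (b := id)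
    (contMDiff_mvfderiv hf p) (hV p)
  rw [Bundle.contMDiffAt_totalSpace] at this
  exact this.2

section
variable [SecondCountableTopology X] [MeasurableSpace X] [BorelSpace X]

theorem riemVolume_restrict_chart (γ : RMetric d X) (q : X) :
    (riemVolume γ).restrict (chartAt (EuclideanSpace ℝ (Fin d)) q).source = chartVolume γ q := by
  ext s hs
  have hm := (chartAt (EuclideanSpace ℝ (Fin d)) q).open_source.measurableSet
  rw [Measure.restrict_apply hs, riemVolume_apply γ q (hs.inter hm) inter_subset_right,
    chartVolume_apply γ q hs, chartVolume_apply γ q (hs.inter hm)]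
  congr 2
  ext y
  simp only [mem_inter_iff, mem_preimage, and_congr_right_iff, and_iff_left_iff_imp]
  intro hy _
  simpa using (extChartAt (𝓡 d) q).map_target hy

theorem integral_riemVolume_eq_chart (γ : RMetric d X) (q : X) {g : X → ℝ}
    (hg : ContinuousOn g (chartAt (EuclideanSpace ℝ (Fin d)) q).source)
    (h0 : ∀ p, p ∉ (chartAt (EuclideanSpace ℝ (Fin d)) q).source → g p = 0) :
    ∫ p, g p ∂(riemVolume γ) = ∫ y in (extChartAt (𝓡 d) q).target,
      volDensity γ q y * g ((extChartAt (𝓡 d) q).symm y) := by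
  have hm := (chartAt (EuclideanSpace ℝ (Fin d)) q).open_source.measurableSet
  have hT : MeasurableSet (extChartAt (𝓡 d) q).target := (isOpen_extChartAt_target q).measurableSet
  rw [← setIntegral_eq_integral_of_forall_compl_eq_zero h0]
  have hae := hg.aestronglyMeasurable (μ := riemVolume γ) hm
  rw [riemVolume_restrict_chart] at hae ⊢
  have hsm : AEMeasurable (extChartAt (𝓡 d) q).symm
      (volume.restrict (extChartAt (𝓡 d) q).target) :=
    (continuousOn_extChartAt_symm q).aemeasurable hT
  rw [chartVolume, integral_map (hsm.mono_ac (withDensity_absolutelyContinuous _ _)) hae,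
    integral_withDensity_eq_integral_toReal_smul₀]
  · refine setIntegral_congr_fun hT fun y hy => ?_
    simp only [ENNReal.toReal_ofReal (volDensity_pos γ q hy).le, smul_eq_mul]
  · exact ((continuousOn_volDensity γ q).aemeasurable hT).ennreal_ofReal
  · simp

/-- The volume density is strictly positive in every chart. This is what upgrades equality almost
everywhere of continuous functions to equality at every point. -/
instance riemVolume_isOpenPos (γ : RMetric d X) : (riemVolume γ).IsOpenPosMeasure where
  open_pos U hU := by
    rintro ⟨q, hq⟩ h0
    have hso := (chartAt (EuclideanSpace ℝ (Fin d)) q).open_source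
    have h1 : riemVolume γ (U ∩ (chartAt (EuclideanSpace ℝ (Fin d)) q).source) = 0 :=
      measure_mono_null inter_subset_left h0
    have hUm := (hU.inter hso).measurableSet
    rw [riemVolume_apply γ q hUm inter_subset_right, chartVolume_apply γ q hUm] at h1
    set B := (extChartAt (𝓡 d) q).target ∩ (extChartAt (𝓡 d) q).symm ⁻¹'
      (U ∩ (chartAt (EuclideanSpace ℝ (Fin d)) q).source)
    have hBo : IsOpen B := (continuousOn_extChartAt_symm q).isOpen_inter_preimage
      (isOpen_extChartAt_target q) (hU.inter hso)
    have hBne : B.Nonempty := ⟨extChartAt (𝓡 d) q q, mem_extChartAt_target q, by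
      rw [mem_preimage, extChartAt_to_inv]
      exact ⟨hq, mem_chart_source _ q⟩⟩
    rw [lintegral_eq_zero_iff' (((continuousOn_volDensity γ q).mono
      inter_subset_left).aemeasurable hBo.measurableSet).ennreal_ofReal, Filter.EventuallyEq,
      ae_restrict_iff' hBo.measurableSet] at h1
    refine (hBo.measure_pos volume hBne).ne' (measure_mono_null (fun y hy => ?_) h1)
    simp [hy, volDensity_pos γ q hy.1]

/-- Integration by parts for a function supported in a chart domain. -/
theorem integral_mul_chartDiv [T2Space X] (γ : RMetric d X) {V : ∀ p : X, TangentSpace (𝓡 d) p}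
    (hV : ContMDiff (𝓡 d) (𝓡 d).tangent ∞ (fun p => (⟨p, V p⟩ : TangentBundle (𝓡 d) X))) {q : X}
    {f : X → ℝ} (hf : ContMDiff (𝓡 d) 𝓘(ℝ) ∞ f) (hc : HasCompactSupport f)
    (hs : tsupport f ⊆ (chartAt (EuclideanSpace ℝ (Fin d)) q).source) :
    ∫ p, f p * chartDiv γ V q p ∂(riemVolume γ) =
      -∫ p, mvfderiv (𝓡 d) f p (V p) ∂(riemVolume γ) := by
  have hT : MeasurableSet (extChartAt (𝓡 d) q).target := (isOpen_extChartAt_target q).measurableSet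
  rw [integral_riemVolume_eq_chart γ q (g := fun p => f p * chartDiv γ V q p)
    (hf.continuous.continuousOn.mul (contMDiffOn_chartDiv γ hV q).continuousOn)
    (fun p hp => by rw [image_eq_zero_of_notMem_tsupport fun h => hp (hs h), zero_mul]),
    integral_riemVolume_eq_chart γ q (contMDiff_mvfderiv_apply hf hV).continuous.continuousOn
    (fun p hp => by rw [mvfderiv_eq_zero_of_notMem_tsupport fun h => hp (hs h)]; simp)]
  let W : Fin d → EuclideanSpace ℝ (Fin d) → ℝ := fun i y => volDensity γ q y * coordComp V q y i
  have key := fun i : Fin d => integral_mul_fderiv_eq_neg_of_tsupport_subset (μ := volume)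
    (isOpen_extChartAt_target (I := 𝓡 d) q)
    ((contDiffOn_volDensity γ q).mul (contDiffOn_coordComp hV q i))
    (contDiff_chartExtend hf hc hs) (hasCompactSupport_chartExtend hc hs)
    (tsupport_chartExtend_subset hc hs) (EuclideanSpace.single i 1)
  -- The density of `dγ` cancels the inverse density in the divergence, leaving `∫ f ∂_i(√det γ
  -- V^i)` over Euclidean space.
  have hL : ∫ y in (extChartAt (𝓡 d) q).target, volDensity γ q y *
      (f ((extChartAt (𝓡 d) q).symm y) * chartDiv γ V q ((extChartAt (𝓡 d) q).symm y)) =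
      ∫ y, ∑ i, fderiv ℝ (W i) y (EuclideanSpace.single i 1) * chartExtend q f y := by
    rw [← setIntegral_eq_integral_of_forall_compl_eq_zero (s := (extChartAt (𝓡 d) q).target)
      (f := fun y => ∑ i, fderiv ℝ (W i) y (EuclideanSpace.single i 1) * chartExtend q f y)
      (fun y hy => by
        simp only [chartExtend, indicator_of_notMem hy, mul_zero, Finset.sum_const_zero])]
    refine setIntegral_congr_fun hT fun y hy => ?_
    have := (volDensity_pos γ q hy).ne'
    simp only [chartDiv, (extChartAt (𝓡 d) q).right_inv hy, chartExtend, indicator_of_mem hy,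
      ← Finset.sum_mul, W]
    field_simp
  have hR : ∫ y in (extChartAt (𝓡 d) q).target, volDensity γ q y *
      mvfderiv (𝓡 d) f ((extChartAt (𝓡 d) q).symm y) (V ((extChartAt (𝓡 d) q).symm y)) =
      ∫ y, ∑ i, W i y * fderiv ℝ (chartExtend q f) y (EuclideanSpace.single i 1) := by
    rw [← setIntegral_eq_integral_of_forall_compl_eq_zero (s := (extChartAt (𝓡 d) q).target)
      (f := fun y => ∑ i, W i y * fderiv ℝ (chartExtend q f) y (EuclideanSpace.single i 1))]
    · refine setIntegral_congr_fun hT fun y hy => ?_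
      simp only [mvfderiv_eq_sum hf V q hy, Finset.mul_sum, W,
        (chartExtend_eventuallyEq f hy).fderiv_eq, mul_assoc]
    · intro y hy
      refine Finset.sum_eq_zero fun i _ => ?_
      have : y ∉ tsupport (fderiv ℝ (chartExtend q f)) := fun h =>
        hy (tsupport_chartExtend_subset hc hs (tsupport_fderiv_subset ℝ h))
      rw [image_eq_zero_of_notMem_tsupport this]
      simp
  rw [hL, hR, integral_finsetSum _ fun i _ => (key i).2.1,
    integral_finsetSum _ fun i _ => (key i).1, ← Finset.sum_neg_distrib]
  refine Finset.sum_congr rfl fun i _ => ?_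
  rw [(key i).2.2, neg_neg]

variable [T2Space X]

/-- Against any test function `f` supported in the overlap, both chart divergences integrate to `-∫
df(V) dγ`, in which no chart appears. Hence they agree almost everywhere there, and everywhere by
continuity. No transformation law for derivatives of the density is needed. -/
theorem chartDiv_eq (γ : RMetric d X) {V : ∀ p : X, TangentSpace (𝓡 d) p}
    (hV : ContMDiff (𝓡 d) (𝓡 d).tangent ∞ (fun p => (⟨p, V p⟩ : TangentBundle (𝓡 d) X)))
    {q r p : X} (hq : p ∈ (chartAt (EuclideanSpace ℝ (Fin d)) q).source)
    (hr : p ∈ (chartAt (EuclideanSpace ℝ (Fin d)) r).source) :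
    chartDiv γ V q p = chartDiv γ V r p := by
  have : LocallyCompactSpace X := ChartedSpace.locallyCompactSpace (EuclideanSpace ℝ (Fin d)) X
  set O := (chartAt (EuclideanSpace ℝ (Fin d)) q).source ∩
    (chartAt (EuclideanSpace ℝ (Fin d)) r).source
  have hO : IsOpen O := (chartAt (EuclideanSpace ℝ (Fin d)) q).open_source.inter
    (chartAt (EuclideanSpace ℝ (Fin d)) r).open_source
  have hcq : ContinuousOn (chartDiv γ V q) O :=
    (contMDiffOn_chartDiv γ hV q).continuousOn.mono inter_subset_left
  have hcr : ContinuousOn (chartDiv γ V r) O :=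
    (contMDiffOn_chartDiv γ hV r).continuousOn.mono inter_subset_right
  have hint : ∀ {h : X → ℝ}, ContinuousOn h O → ∀ {g : X → ℝ}, Continuous g → HasCompactSupport g →
      tsupport g ⊆ O → Integrable (fun x => g x * h x) (riemVolume γ) := by
    intro h hh g hg hgc hgs
    have h1 : tsupport (fun x => g x * h x) ⊆ tsupport g :=
      closure_mono (Function.support_mul_subset_left g h)
    have h2 : Continuous (fun x => g x * h x) :=
      continuous_of_tsupport fun x hx => (hg.continuousOn.mul hh).continuousAt
        (hO.mem_nhds (hgs (h1 hx)))
    exact h2.integrable_of_hasCompactSupport hgc.mul_right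
  have hae := hO.ae_eq_zero_of_integral_contMDiff_smul_eq_zero (𝓡 d) (μ := riemVolume γ)
    (f := fun x => chartDiv γ V q x - chartDiv γ V r x)
    ((hcq.sub hcr).locallyIntegrableOn hO.measurableSet) (by
      intro g hg hgc hgs
      simp only [smul_eq_mul, mul_sub]
      rw [integral_sub (hint hcq hg.continuous hgc hgs) (hint hcr hg.continuous hgc hgs),
        integral_mul_chartDiv γ hV hg hgc (hgs.trans inter_subset_left),
        integral_mul_chartDiv γ hV hg hgc (hgs.trans inter_subset_right), sub_self])
  refine Measure.eqOn_open_of_ae_eq (μ := riemVolume γ) ?_ hO hcq hcr ⟨hq, hr⟩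
  rw [Filter.EventuallyEq, ae_restrict_iff' hO.measurableSet]
  filter_upwards [hae] with x hx hxO using sub_eq_zero.1 (hx hxO)

/-- The chart in `divergence` changes from point to point; near a given point it may now be frozen,
which gives smoothness and the integral formula. -/
theorem divergence_eq_chartDiv (γ : RMetric d X) {V : ∀ p : X, TangentSpace (𝓡 d) p}
    (hV : ContMDiff (𝓡 d) (𝓡 d).tangent ∞ (fun p => (⟨p, V p⟩ : TangentBundle (𝓡 d) X)))
    {q p : X} (hp : p ∈ (chartAt (EuclideanSpace ℝ (Fin d)) q).source) :
    divergence γ V p = chartDiv γ V q p :=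
  chartDiv_eq γ hV (mem_chart_source _ p) hp

theorem contMDiff_divergence (γ : RMetric d X) {V : ∀ p : X, TangentSpace (𝓡 d) p}
    (hV : ContMDiff (𝓡 d) (𝓡 d).tangent ∞ (fun p => (⟨p, V p⟩ : TangentBundle (𝓡 d) X))) :
    ContMDiff (𝓡 d) 𝓘(ℝ) ∞ (divergence γ V) := by
  intro q
  have hU : (chartAt (EuclideanSpace ℝ (Fin d)) q).source ∈ 𝓝 q :=
    (chartAt (EuclideanSpace ℝ (Fin d)) q).open_source.mem_nhds (mem_chart_source _ q)
  refine ((contMDiffOn_chartDiv γ hV q).contMDiffAt hU).congr_of_eventuallyEq ?_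
  filter_upwards [hU] with p hp using divergence_eq_chartDiv γ hV hp

/-- Integration by parts for a function supported in a chart domain. -/
theorem integral_mul_divergence_of_chart (γ : RMetric d X) {V : ∀ p : X, TangentSpace (𝓡 d) p}
    (hV : ContMDiff (𝓡 d) (𝓡 d).tangent ∞ (fun p => (⟨p, V p⟩ : TangentBundle (𝓡 d) X))) {q : X}
    {f : X → ℝ} (hf : ContMDiff (𝓡 d) 𝓘(ℝ) ∞ f) (hc : HasCompactSupport f)
    (hs : tsupport f ⊆ (chartAt (EuclideanSpace ℝ (Fin d)) q).source) :
    ∫ p, f p * divergence γ V p ∂(riemVolume γ) =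
      -∫ p, mvfderiv (𝓡 d) f p (V p) ∂(riemVolume γ) := by
  rw [← integral_mul_chartDiv γ hV hf hc hs]
  refine integral_congr_ae (Filter.Eventually.of_forall fun p => ?_)
  by_cases hp : p ∈ tsupport f
  · simp only [divergence_eq_chartDiv γ hV (hs hp)]
  · simp only [image_eq_zero_of_notMem_tsupport hp, zero_mul]

theorem integrable_mvfderiv_apply (γ : RMetric d X) {V : ∀ p : X, TangentSpace (𝓡 d) p}
    (hV : ContMDiff (𝓡 d) (𝓡 d).tangent ∞ (fun p => (⟨p, V p⟩ : TangentBundle (𝓡 d) X)))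
    {f : X → ℝ} (hf : ContMDiff (𝓡 d) 𝓘(ℝ) ∞ f) (hc : HasCompactSupport f) :
    Integrable (fun p => mvfderiv (𝓡 d) f p (V p)) (riemVolume γ) :=
  (contMDiff_mvfderiv_apply hf hV).continuous.integrable_of_hasCompactSupport
    (HasCompactSupport.intro hc.isCompact fun p hp => by
      rw [mvfderiv_eq_zero_of_notMem_tsupport hp]; rfl)

theorem integrable_mul_divergence (γ : RMetric d X) {V : ∀ p : X, TangentSpace (𝓡 d) p}
    (hV : ContMDiff (𝓡 d) (𝓡 d).tangent ∞ (fun p => (⟨p, V p⟩ : TangentBundle (𝓡 d) X)))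
    {f : X → ℝ} (hf : ContMDiff (𝓡 d) 𝓘(ℝ) ∞ f) (hc : HasCompactSupport f) :
    Integrable (fun p => f p * divergence γ V p) (riemVolume γ) :=
  (hf.continuous.mul (contMDiff_divergence γ hV).continuous).integrable_of_hasCompactSupport
    hc.mul_right

/-- Integration by parts: `∫ f D_a V^a dγ = -∫ V^a D_a f dγ` for `f` of compact support. -/
theorem integral_mul_divergence (γ : RMetric d X) {V : ∀ p : X, TangentSpace (𝓡 d) p}
    (hV : ContMDiff (𝓡 d) (𝓡 d).tangent ∞ (fun p => (⟨p, V p⟩ : TangentBundle (𝓡 d) X)))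
    {f : X → ℝ} (hf : ContMDiff (𝓡 d) 𝓘(ℝ) ∞ f) (hc : HasCompactSupport f) :
    ∫ p, f p * divergence γ V p ∂(riemVolume γ) =
      -∫ p, mvfderiv (𝓡 d) f p (V p) ∂(riemVolume γ) := by
  have : LocallyCompactSpace X := ChartedSpace.locallyCompactSpace (EuclideanSpace ℝ (Fin d)) X
  obtain ⟨ρ, hρ⟩ := SmoothPartitionOfUnity.exists_isSubordinate_chartAt_source (𝓡 d) X
  -- Only finitely many members of the locally finite partition meet the compact support of `f`, so
  -- the decomposition below is a finite sum of functions supported in charts.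
  have hfin : {i | (Function.support (ρ i) ∩ tsupport f).Nonempty}.Finite :=
    ρ.locallyFinite.finite_nonempty_inter_compact hc.isCompact
  set s := hfin.toFinset
  have hsum : f = fun p => ∑ i ∈ s, ρ i p * f p := by
    ext p
    by_cases hp : p ∈ tsupport f
    · have h1 : ∑ᶠ i, ρ i p = ∑ i ∈ s, ρ i p := by
        refine finsum_eq_sum_of_support_subset _ fun i hi => ?_
        simp only [s, Finite.coe_toFinset, mem_ofPred_eq]
        exact ⟨p, hi, hp⟩
      rw [← Finset.sum_mul, ← h1, ρ.sum_eq_one (mem_univ p), one_mul]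
    · simp [image_eq_zero_of_notMem_tsupport hp]
  have hfi : ∀ i, ContMDiff (𝓡 d) 𝓘(ℝ) ∞ fun p => ρ i p * f p := fun i => (ρ i).contMDiff.mul hf
  have hci : ∀ i, HasCompactSupport fun p => ρ i p * f p := fun i => hc.mul_left
  have hsi : ∀ i, tsupport (fun p => ρ i p * f p) ⊆
      (chartAt (EuclideanSpace ℝ (Fin d)) i).source := fun i =>
    (closure_mono (Function.support_mul_subset_left (ρ i) f)).trans (hρ i)
  have hL : ∀ p, f p * divergence γ V p = ∑ i ∈ s, ρ i p * f p * divergence γ V p := by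
    intro p
    rw [← Finset.sum_mul]
    exact congrArg (· * _) (congrFun hsum p)
  have hR : ∀ p, mvfderiv (𝓡 d) f p (V p) =
      ∑ i ∈ s, mvfderiv (𝓡 d) (fun p => ρ i p * f p) p (V p) := by
    intro p
    conv_lhs => rw [hsum]
    rw [mvfderiv_finsetSum s fun i => (hfi i).mdifferentiableAt (by simp)]
    simp
  simp only [hL, hR]
  rw [integral_finsetSum _ fun i _ => integrable_mul_divergence γ hV (hfi i) (hci i),
    integral_finsetSum _ fun i _ => integrable_mvfderiv_apply γ hV (hfi i) (hci i),
    ← Finset.sum_neg_distrib]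
  exact Finset.sum_congr rfl fun i _ =>
    integral_mul_divergence_of_chart γ hV (hfi i) (hci i) (hsi i)

end
end DivergenceTheorem

/-! ### Continuity of `σ` in the energy norm, and its relation to `h`. -/

section SymplecticForm

/-! ### Extending bilinear forms to the completion -/

/-- Rescaling the two arguments to equal size turns the sum of squares into a product. -/
theorem abs_bilin_le_of_abs_le_sq {E : Type*} [SeminormedAddCommGroup E] [NormedSpace ℝ E]
    (B : E →ₗ[ℝ] E →ₗ[ℝ] ℝ) {C : ℝ} (hC : 0 ≤ C) (h : ∀ x y, |B x y| ≤ C * (‖x‖ ^ 2 + ‖y‖ ^ 2))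
    (x y : E) : |B x y| ≤ 2 * C * ‖x‖ * ‖y‖ := by
  -- The arguments are scaled by `‖y‖ + δ` and `‖x‖ + δ`; the shift keeps the factors invertible
  -- when a seminorm vanishes, and `δ → 0` at the end.
  have h1 : ∀ δ : ℝ, 0 < δ → |B x y| ≤ 2 * C * (‖x‖ + δ) * (‖y‖ + δ) := by
    intro δ hδ
    have hx : 0 < ‖x‖ + δ := by positivity
    have hy : 0 < ‖y‖ + δ := by positivity
    have := h ((‖y‖ + δ) • x) ((‖x‖ + δ) • y)
    simp only [map_smul, LinearMap.smul_apply, smul_eq_mul, abs_mul, norm_smul, Real.norm_eq_abs,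
      abs_of_pos hx, abs_of_pos hy] at this
    have h2 : ((‖y‖ + δ) * ‖x‖) ^ 2 ≤ ((‖x‖ + δ) * (‖y‖ + δ)) ^ 2 := by
      rw [mul_comm (‖x‖ + δ)]; gcongr; linarith
    have h3 : ((‖x‖ + δ) * ‖y‖) ^ 2 ≤ ((‖x‖ + δ) * (‖y‖ + δ)) ^ 2 := by gcongr; linarith
    refine le_of_mul_le_mul_left ?_ (mul_pos hx hy)
    nlinarith [mul_le_mul_of_nonneg_left h2 hC, mul_le_mul_of_nonneg_left h3 hC]
  have hc : Continuous fun δ : ℝ => 2 * C * (‖x‖ + δ) * (‖y‖ + δ) := by fun_prop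
  have ht : Filter.Tendsto (fun δ : ℝ => 2 * C * (‖x‖ + δ) * (‖y‖ + δ)) (𝓝[>] 0)
      (𝓝 (2 * C * ‖x‖ * ‖y‖)) := by
    have := (hc.tendsto 0).mono_left (nhdsWithin_le_nhds (s := Ioi 0))
    simpa using this
  exact ge_of_tendsto ht (Filter.eventually_of_mem self_mem_nhdsWithin h1)

theorem exists_extension_bilin {E : Type*} [SeminormedAddCommGroup E] [NormedSpace ℝ E]
    (B : E →L[ℝ] E →L[ℝ] ℝ) :
    ∃ B' : UniformSpace.Completion E →L[ℝ] UniformSpace.Completion E →L[ℝ] ℝ,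
      ∀ x y : E, B' x y = B x y := by
  let e : E →L[ℝ] UniformSpace.Completion E := UniformSpace.Completion.toComplL
  have hd : DenseRange e := UniformSpace.Completion.denseRange_coe
  have hi : IsUniformInducing e := UniformSpace.Completion.isUniformInducing_coe E
  let B₁ : UniformSpace.Completion E →L[ℝ] E →L[ℝ] ℝ := B.extend e
  have h₁ : ∀ x : E, B₁ x = B x := fun x => ContinuousLinearMap.extend_eq B hd hi x
  let B₂ : UniformSpace.Completion E →L[ℝ] UniformSpace.Completion E →L[ℝ] ℝ := B₁.flip.extend e
  have h₂ : ∀ y : E, B₂ y = B₁.flip y := fun y => ContinuousLinearMap.extend_eq B₁.flip hd hi y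
  refine ⟨B₂.flip, fun x y => ?_⟩
  rw [ContinuousLinearMap.flip_apply, h₂, ContinuousLinearMap.flip_apply, h₁]

/-! ### The symplectic form on the energy space -/

variable {d : ℕ} {X : Type*} [TopologicalSpace X] [ChartedSpace (EuclideanSpace ℝ (Fin d)) X]
  [IsManifold (𝓡 d) ∞ X] [T2Space X] [SecondCountableTopology X] [MeasurableSpace X] [BorelSpace X]
  {S : SliceData d X} {m : ℝ}

theorem inner_eq_integral (F G : InitialData S m) :
    inner ℝ F G = ∫ p, InitialData.energyDensity F G p ∂(riemVolume S.γ) := rfl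

theorem norm_sq_eq_integral (F : InitialData S m) :
    ‖F‖ ^ 2 = ∫ p, InitialData.energyDensity F F p ∂(riemVolume S.γ) := by
  rw [← real_inner_self_eq_norm_sq, inner_eq_integral]

theorem inner_self_nonneg_metric (γ : RMetric d X) (p : X) (v : TangentSpace (𝓡 d) p) :
    0 ≤ γ.inner p v v := by
  by_cases h : v = 0
  · simp [h]
  · exact (γ.pos p _ h).le

/-- The coefficient of `π²` is `α - β²/α ≥ ε`, which also forces `α ≥ ε` in front of the mass term;
the gradient term is nonnegative and is dropped. -/
theorem le_energyDensity {ε : ℝ}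
    (hshift : ∀ p : X, ε ≤ S.α p - S.γ.inner p (S.β p) (S.β p) / S.α p)
    (F : InitialData S m) (p : X) :
    ε * (F.mom p ^ 2 + m ^ 2 * F.fld p ^ 2) ≤ InitialData.energyDensity F F p := by
  have h0 := S.α_pos p
  have h1 := hshift p
  have h2 := inner_self_nonneg_metric S.γ p (S.β p)
  have h3 := inner_self_nonneg_metric S.γ p (F.vec p)
  have h4 : 0 ≤ S.γ.inner p (S.β p) (S.β p) / S.α p := div_nonneg h2 h0.le
  have h5 : ε ≤ S.α p := by linarith
  have h6 : InitialData.energyDensity F F p =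
      (S.α p - S.γ.inner p (S.β p) (S.β p) / S.α p) * F.mom p ^ 2 +
        S.α p * S.γ.inner p (F.vec p) (F.vec p) + S.α p * (m ^ 2 * F.fld p ^ 2) := by
    rw [InitialData.energyDensity]
    field_simp
  rw [h6]
  have h7 := mul_le_mul_of_nonneg_right h1 (sq_nonneg (F.mom p))
  have h8 := mul_le_mul_of_nonneg_right h5 (mul_nonneg (sq_nonneg m) (sq_nonneg (F.fld p)))
  have h9 := mul_nonneg h0.le h3
  linarith

theorem integrable_sigma (F G : InitialData S m) : Integrable
    (fun p => F.fld p * (opJ (G.fld, G.mom)).1 p + F.mom p * (opJ (G.fld, G.mom)).2 p)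
    (riemVolume S.γ) := by
  refine Continuous.integrable_of_hasCompactSupport ?_ ?_
  · exact (F.contMDiff_fld.continuous.mul G.contMDiff_mom.continuous).add
      (F.contMDiff_mom.continuous.mul G.contMDiff_fld.continuous.neg)
  · exact (HasCompactSupport.mul_right F.1.2.2).add (HasCompactSupport.mul_right F.2.2.2)

/-- The symplectic form as a bilinear map. -/
def sigmaBilin (S : SliceData d X) (m : ℝ) :
    InitialData S m →ₗ[ℝ] InitialData S m →ₗ[ℝ] ℝ :=
  LinearMap.mk₂ ℝ sigma
    (fun F F' G => by
      rw [sigma, sigma, sigma, ← integral_add (integrable_sigma F G) (integrable_sigma F' G)]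
      refine integral_congr_ae (Filter.Eventually.of_forall fun p => ?_)
      have h1 : (F + F').fld p = F.fld p + F'.fld p := rfl
      have h2 : (F + F').mom p = F.mom p + F'.mom p := rfl
      simp only [h1, h2]
      ring)
    (fun c F G => by
      rw [sigma, sigma, smul_eq_mul, ← integral_const_mul]
      refine integral_congr_ae (Filter.Eventually.of_forall fun p => ?_)
      have h1 : (c • F).fld p = c * F.fld p := rfl
      have h2 : (c • F).mom p = c * F.mom p := rfl
      simp only [h1, h2]
      ring)
    (fun F G G' => by
      rw [sigma, sigma, sigma, ← integral_add (integrable_sigma F G) (integrable_sigma F G')]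
      refine integral_congr_ae (Filter.Eventually.of_forall fun p => ?_)
      have h1 : (G + G').fld p = G.fld p + G'.fld p := rfl
      have h2 : (G + G').mom p = G.mom p + G'.mom p := rfl
      simp only [opJ, Pi.neg_apply, h1, h2]
      ring)
    (fun c F G => by
      rw [sigma, sigma, smul_eq_mul, ← integral_const_mul]
      refine integral_congr_ae (Filter.Eventually.of_forall fun p => ?_)
      have h1 : (c • G).fld p = c * G.fld p := rfl
      have h2 : (c • G).mom p = c * G.mom p := rfl
      simp only [opJ, Pi.neg_apply, h1, h2]
      ring)

theorem sigma_antisymm (F G : InitialData S m) : sigma F G = -sigma G F := by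
  rw [sigma, sigma, ← integral_neg]
  refine integral_congr_ae (Filter.Eventually.of_forall fun p => ?_)
  simp only [opJ, Pi.neg_apply]
  ring

theorem exists_abs_sigma_le (hmass : 0 < m ^ 2) {ε : ℝ} (hε : 0 < ε)
    (hshift : ∀ p : X, ε ≤ S.α p - S.γ.inner p (S.β p) (S.β p) / S.α p) :
    ∃ C : ℝ, 0 ≤ C ∧ ∀ F G : InitialData S m, |sigma F G| ≤ C * (‖F‖ ^ 2 + ‖G‖ ^ 2) := by
  -- With this `c`, the energy density dominates `c (π² + φ²)`; positivity of `c` needs the positive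
  -- mass.
  set c := ε * min 1 (m ^ 2)
  have hc : 0 < c := mul_pos hε (lt_min one_pos hmass)
  have hle : ∀ (F : InitialData S m) p,
      F.mom p ^ 2 + F.fld p ^ 2 ≤ c⁻¹ * InitialData.energyDensity F F p := by
    intro F p
    rw [inv_mul_eq_div, le_div_iff₀ hc]
    refine le_trans ?_ (le_energyDensity hshift F p)
    have h1 := mul_le_mul_of_nonneg_right (min_le_left 1 (m ^ 2)) (sq_nonneg (F.mom p))
    have h2 := mul_le_mul_of_nonneg_right (min_le_right 1 (m ^ 2)) (sq_nonneg (F.fld p))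
    have h3 : (F.mom p ^ 2 + F.fld p ^ 2) * c =
      ε * (min 1 (m ^ 2) * F.mom p ^ 2 + min 1 (m ^ 2) * F.fld p ^ 2) := by ring
    rw [h3]
    gcongr
    linarith
  refine ⟨c⁻¹, (inv_pos.2 hc).le, fun F G => ?_⟩
  rw [norm_sq_eq_integral, norm_sq_eq_integral, ← integral_add
    (InitialData.integrable_energyDensity F F) (InitialData.integrable_energyDensity G G),
    ← integral_const_mul, sigma, ← Real.norm_eq_abs]
  refine norm_integral_le_of_norm_le (((InitialData.integrable_energyDensity F F).add
    (InitialData.integrable_energyDensity G G)).const_mul _)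
    (Filter.Eventually.of_forall fun p => ?_)
  simp only [opJ, Pi.neg_apply, Real.norm_eq_abs]
  have h1 := hle F p
  have h2 := hle G p
  rw [abs_le]
  constructor <;> nlinarith [sq_nonneg (F.fld p + G.mom p), sq_nonneg (F.fld p - G.mom p),
    sq_nonneg (F.mom p + G.fld p), sq_nonneg (F.mom p - G.fld p)]

theorem exists_sigma_extension (hmass : 0 < m ^ 2) {ε : ℝ} (hε : 0 < ε)
    (hshift : ∀ p : X, ε ≤ S.α p - S.γ.inner p (S.β p) (S.β p) / S.α p) :
    ∃ σ' : EnergySpace S m →L[ℝ] EnergySpace S m →L[ℝ] ℝ,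
      ∀ F G : InitialData S m, σ' F G = sigma F G := by
  obtain ⟨C, hC, h⟩ := exists_abs_sigma_le (S := S) hmass hε hshift
  exact exists_extension_bilin ((sigmaBilin S m).mkContinuous₂ (2 * C)
    (abs_bilin_le_of_abs_le_sq (sigmaBilin S m) hC h))

/-! ### The evolution operator on smooth data -/

theorem divergence_eq_zero (γ : RMetric d X) {V : ∀ p : X, TangentSpace (𝓡 d) p} {q : X}
    (hV : ∀ᶠ p in 𝓝 q, V p = 0) : divergence γ V q = 0 := by
  have h1 : ∀ᶠ y in 𝓝 (extChartAt (𝓡 d) q q), V ((extChartAt (𝓡 d) q).symm y) = 0 := by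
    have := continuousAt_extChartAt_symm (I := 𝓡 d) q
    rw [ContinuousAt, extChartAt_to_inv] at this
    exact this.eventually hV
  rw [divergence, Finset.sum_eq_zero, mul_zero]
  intro i _
  have h2 : (fun y => volDensity γ q y * coordComp V q y i) =ᶠ[𝓝 (extChartAt (𝓡 d) q q)]
      fun _ => (0 : ℝ) := by
    filter_upwards [h1] with y hy
    simp only [coordComp, hy, map_zero, PiLp.zero_apply, mul_zero]
  rw [h2.fderiv_eq]
  simp

theorem laplacian_eq_zero (γ : RMetric d X) {f : X → ℝ} {q : X} (hq : q ∉ tsupport f) :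
    laplacian γ f q = 0 := by
  refine divergence_eq_zero γ ?_
  filter_upwards [(isClosed_tsupport f).isOpen_compl.mem_nhds hq] with p hp
  simp [grad, sharp, mvfderiv_eq_zero_of_notMem_tsupport (d := d) hp]

theorem contMDiff_laplacian (γ : RMetric d X) {f : X → ℝ} (hf : ContMDiff (𝓡 d) 𝓘(ℝ) ∞ f) :
    ContMDiff (𝓡 d) 𝓘(ℝ) ∞ (laplacian γ f) :=
  contMDiff_divergence γ (contMDiff_grad γ hf)

/-- A differential operator with smooth coefficients preserves smoothness and does not enlarge
supports. -/
theorem opH_mem_testFn (F : InitialData S m) :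
    (opH S m (F.fld, F.mom)).1 ∈ testFn d X ∧ (opH S m (F.fld, F.mom)).2 ∈ testFn d X := by
  have hK := F.1.2.2.isCompact.union F.2.2.2.isCompact
  refine ⟨⟨?_, ?_⟩, ⟨?_, ?_⟩⟩
  · exact ((contMDiff_mvfderiv_apply F.contMDiff_fld S.contMDiff_β).add
      (S.contMDiff_α.mul F.contMDiff_mom)).neg
  · refine HasCompactSupport.intro hK fun p hp => ?_
    have h1 : p ∉ tsupport F.fld := fun h => hp (Or.inl h)
    have h2 : p ∉ tsupport F.mom := fun h => hp (Or.inr h)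
    simp [opH, opJ, opA, mvfderiv_eq_zero_of_notMem_tsupport (d := d) h1,
      image_eq_zero_of_notMem_tsupport h2]
  · exact (((((contMDiff_mvfderiv_apply F.contMDiff_fld
      (contMDiff_grad S.γ S.contMDiff_α)).neg.add (S.contMDiff_α.mul
        ((contMDiff_const.mul F.contMDiff_fld).sub (contMDiff_laplacian S.γ F.contMDiff_fld)))).sub
      ((contMDiff_divergence S.γ S.contMDiff_β).mul F.contMDiff_mom)).sub
      (contMDiff_mvfderiv_apply F.contMDiff_mom S.contMDiff_β)).neg).neg
  · refine HasCompactSupport.intro hK fun p hp => ?_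
    have h1 : p ∉ tsupport F.fld := fun h => hp (Or.inl h)
    have h2 : p ∉ tsupport F.mom := fun h => hp (Or.inr h)
    simp [opH, opJ, opA, mvfderiv_eq_zero_of_notMem_tsupport (d := d) h1,
      mvfderiv_eq_zero_of_notMem_tsupport (d := d) h2, laplacian_eq_zero S.γ h1,
      image_eq_zero_of_notMem_tsupport h1, image_eq_zero_of_notMem_tsupport h2]

/-- `h F` as an element of `C₀^∞ ⊕ C₀^∞`. -/
def hData (F : InitialData S m) : InitialData S m :=
  (⟨_, (opH_mem_testFn F).1⟩, ⟨_, (opH_mem_testFn F).2⟩)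

theorem hData_eq (F : InitialData S m) :
    ((hData F).fld, (hData F).mom) = opH S m (F.fld, F.mom) := rfl

theorem inner_grad (γ : RMetric d X) (f : X → ℝ) (p : X) (v : TangentSpace (𝓡 d) p) :
    γ.inner p (grad γ f p) v = mvfderiv (𝓡 d) f p v :=
  congrArg (fun l => l v) (inner_sharp γ p _)

theorem mvfderiv_grad_comm (γ : RMetric d X) (f g : X → ℝ) (p : X) :
    mvfderiv (𝓡 d) f p (grad γ g p) = mvfderiv (𝓡 d) g p (grad γ f p) := by
  rw [← inner_grad, ← inner_grad, γ.symm]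

/-- Expanding the square, the term `(β²/α) π π'` cancels against the one in the bracket `1 - β²/α²`,
so the form is polynomial in the lapse, the shift and the data. -/
theorem energyDensity_eq (F G : InitialData S m) (p : X) :
    InitialData.energyDensity F G p = S.α p * (F.mom p * G.mom p)
      + S.α p * mvfderiv (𝓡 d) F.fld p (grad S.γ G.fld p)
      + G.mom p * mvfderiv (𝓡 d) F.fld p (S.β p) + F.mom p * mvfderiv (𝓡 d) G.fld p (S.β p)
      + m ^ 2 * S.α p * (F.fld p * G.fld p) := by
  have h0 := (S.α_pos p).ne'
  have h1 : S.γ.inner p (S.β p) (grad S.γ G.fld p) = mvfderiv (𝓡 d) G.fld p (S.β p) := by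
    rw [S.γ.symm, inner_grad]
  simp only [InitialData.energyDensity, InitialData.vec, map_add, map_smul, add_apply, smul_apply,
    smul_eq_mul, inner_grad, h1]
  field_simp
  ring

/-- The identity behind the whole theorem: with `G = (ψ, ·)` and `F = (φ, π)`, the two integrands
differ exactly by the divergences of `ψ α Dφ` and `ψ π β`, which integrate to zero. -/
theorem sigma_hData (G F : InitialData S m) : sigma G (hData F) = inner ℝ G F := by
  have h_fld_α : ContMDiff (𝓡 d) 𝓘(ℝ) ∞ fun p => G.fld p * S.α p :=
    G.contMDiff_fld.mul S.contMDiff_α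
  have h_fld_mom : ContMDiff (𝓡 d) 𝓘(ℝ) ∞ fun p => G.fld p * F.mom p :=
    G.contMDiff_fld.mul F.contMDiff_mom
  have hcα : HasCompactSupport fun p => G.fld p * S.α p := HasCompactSupport.mul_right G.1.2.2
  have hcπ : HasCompactSupport fun p => G.fld p * F.mom p := HasCompactSupport.mul_right G.1.2.2
  have hgr := contMDiff_grad S.γ F.contMDiff_fld
  have h1 := integral_mul_divergence S.γ hgr h_fld_α hcα
  have h2 := integral_mul_divergence S.γ S.contMDiff_β h_fld_mom hcπ
  have i1 := integrable_mul_divergence S.γ hgr h_fld_α hcα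
  have i2 := integrable_mul_divergence S.γ S.contMDiff_β h_fld_mom hcπ
  have j1 := integrable_mvfderiv_apply S.γ hgr h_fld_α hcα
  have j2 := integrable_mvfderiv_apply S.γ S.contMDiff_β h_fld_mom hcπ
  have i3 := InitialData.integrable_energyDensity G F
  have key : ∀ p, G.fld p * (opJ ((hData F).fld, (hData F).mom)).1 p +
      G.mom p * (opJ ((hData F).fld, (hData F).mom)).2 p =
      InitialData.energyDensity G F p -
      ((G.fld p * S.α p * divergence S.γ (grad S.γ F.fld) p +
        mvfderiv (𝓡 d) (fun p => G.fld p * S.α p) p (grad S.γ F.fld p)) +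
      (G.fld p * F.mom p * divergence S.γ S.β p +
        mvfderiv (𝓡 d) (fun p => G.fld p * F.mom p) p (S.β p))) := by
    intro p
    have dG := G.contMDiff_fld.mdifferentiableAt (x := p) (n := ∞) (by simp)
    have dα := S.contMDiff_α.mdifferentiableAt (x := p) (n := ∞) (by simp)
    have dF := F.contMDiff_mom.mdifferentiableAt (x := p) (n := ∞) (by simp)
    rw [hData_eq, energyDensity_eq, mvfderiv_fun_mul dG dα, mvfderiv_fun_mul dG dF]
    simp only [opH, opJ, opA, Prod.fst_neg, Prod.snd_neg, Pi.neg_apply, add_apply, smul_apply,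
      smul_eq_mul, mvfderiv_grad_comm S.γ F.fld S.α p, laplacian]
    ring
  rw [sigma, inner_eq_integral]
  simp only [key]
  rw [integral_sub i3 ((i1.fun_add j1).fun_add (i2.fun_add j2)),
    integral_add (i1.fun_add j1) (i2.fun_add j2),
    integral_add i1 j1, integral_add i2 j2, h1, h2]
  simp

end SymplecticForm
end StationaryKG
end

/-! ### Assembly: Riesz representation of `σ`, its inverse, and the conserved group. -/

theorem theorem4p2 {d : ℕ}
    {M : Type*} [TopologicalSpace M] [ChartedSpace (EuclideanSpace ℝ (Fin (d + 1))) M]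
    [IsManifold (𝓡 (d + 1)) ∞ M]
    {X : Type*} [TopologicalSpace X] [ChartedSpace (EuclideanSpace ℝ (Fin d)) X]
    [IsManifold (𝓡 d) ∞ X] [T2Space X] [SecondCountableTopology X]
    [MeasurableSpace X] [BorelSpace X]
    (N : StationaryKG.StationarySpacetime d M) (C : StationaryKG.SpatialSlice N X)
    (m : ℝ) (hmass : 0 < m ^ 2)
    (ε : ℝ) (hε : 0 < ε)
    (hshift : ∀ p : X, ε ≤ C.data.α p - C.data.γ.inner p (C.data.β p) (C.data.β p) / C.data.α p) :
    -- `σ` extends to a continuous bilinear form `σ'` on the energy space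
    ∃ σ' : StationaryKG.EnergySpace C.data m →L[ℝ] StationaryKG.EnergySpace C.data m →L[ℝ] ℝ,
      (∀ F G : StationaryKG.InitialData C.data m, σ' F G = StationaryKG.sigma F G) ∧
    -- which is represented by a bounded skew-adjoint operator `T`
    ∃ T : StationaryKG.EnergySpace C.data m →L[ℝ] StationaryKG.EnergySpace C.data m,
      (∀ Φ Ψ, σ' Φ Ψ = inner ℝ Φ (T Ψ)) ∧
      ContinuousLinearMap.adjoint T = -T ∧
    -- `A = T⁻¹` is a skew-adjoint extension of `h`
    ∃ A : StationaryKG.EnergySpace C.data m →ₗ.[ℝ] StationaryKG.EnergySpace C.data m,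
      (∀ Φ Ψ, (Φ, Ψ) ∈ A.graph ↔ T Ψ = Φ) ∧
      StationaryKG.IsSkewAdjointOp A ∧
      StationaryKG.ExtendsH A ∧
    -- and the evolution `e^{-At}` conserves `σ`
    ∃ U : ℝ → StationaryKG.EnergySpace C.data m →L[ℝ] StationaryKG.EnergySpace C.data m,
      StationaryKG.IsEvolution A U ∧
      ∀ t Φ Ψ, σ' (U t Φ) (U t Ψ) = σ' Φ Ψ := by
  obtain ⟨σ', hσ⟩ := StationaryKG.exists_sigma_extension (S := C.data) hmass hε hshift
  have hanti : ∀ Φ Ψ, σ' Φ Ψ = -σ' Ψ Φ := by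
    intro Φ Ψ
    induction Φ, Ψ using UniformSpace.Completion.induction_on₂ with
    | hp => exact isClosed_eq (by fun_prop) (by fun_prop)
    | ih F G => rw [hσ, hσ, StationaryKG.sigma_antisymm]
  -- The representing operator acts on the first argument of its form; the flip makes `T` act on the
  -- second argument of `σ'`.
  let T := InnerProductSpace.continuousLinearMapOfBilin (𝕜 := ℝ) σ'.flip
  have hT : ∀ Φ Ψ, σ' Φ Ψ = inner ℝ Φ (T Ψ) := by
    intro Φ Ψ
    rw [real_inner_comm]
    exact (InnerProductSpace.continuousLinearMapOfBilin_apply σ'.flip Ψ Φ).symm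
  have hadj : ContinuousLinearMap.adjoint T = -T := by
    symm
    rw [ContinuousLinearMap.eq_adjoint_iff]
    intro Φ Ψ
    rw [← hT, hanti, hT, neg_apply, inner_neg_left, real_inner_comm]
  -- Tested against smooth `G`: `⟨G, T h F⟩ = σ(G, h F) = ⟨G, F⟩`. This gives both the density of
  -- the range of `T` and the inclusion of `h` in `T⁻¹`.
  have hext : ∀ F : StationaryKG.InitialData C.data m, T (StationaryKG.hData F) = F := by
    intro F
    refine UniformSpace.Completion.denseRange_coe.eq_of_inner_right ℝ fun G => ?_
    rw [← hT, hσ, StationaryKG.sigma_hData, UniformSpace.Completion.inner_coe]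
  have hd : DenseRange T := by
    refine UniformSpace.Completion.denseRange_coe.mono ?_
    rintro _ ⟨F, rfl⟩
    exact ⟨_, hext F⟩
  have hi := StationaryKG.injective_of_skew hadj hd
  obtain ⟨U, hU⟩ := StationaryKG.exists_evolution hadj hd
  refine ⟨σ', hσ, T, hT, hadj, StationaryKG.inverseOp T, StationaryKG.mem_graph_inverseOp hi,
    StationaryKG.isSkewAdjointOp_inverseOp hadj hd, fun F => ⟨StationaryKG.hData F, rfl, ?_⟩, U,
    StationaryKG.isEvolution_inverseOp hadj hU hd, fun t Φ Ψ => ?_⟩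
  · exact (StationaryKG.mem_graph_inverseOp hi _ _).2 (hext F)
  · rw [hT, hT, ← StationaryKG.evolution_commute hadj hU, StationaryKG.inner_evolution hadj hU]
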